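/- Let $n\ge 2$ and let $\mathfrak a_n$ be the unique positive solution of $(1+\mathfrak a_n)^n=1+2n\mathfrak a_n$. Let $\mathbf G$ be a Riemann surface spread over the $\xi$-plane (a Hausdorff space with a local homeomorphism $\xi:\mathbf G\to\mathbb C$ serving as coordinate, for example a domain in $\mathbb C$); points are denoted by their coordinate $\xi$, derivatives are taken with respect to $\xi$, and $\xi+te^{i\alpha}$, $t\ge 0$, denotes the path in $\mathbf G$ that starts at the given point and lies over the corresponding half-line. Let $\Delta\subseteq\mathbf G$ be a non-empty domain, and for $0\le k\le n-2$ let $\psi_k(u,\xi)$ be functions with asymptotic expansions $$\psi_k(u,\xi)\sim\delta_{0,k}+\sum_{m\ge1}\frac{\psi_{k,m}(\xi)}{u^m}\qquad(u\to+\infty,\ \xi\in\Delta).$$ Put $U(r)=\{t:\operatorname{Re}t>0,|\operatorname{Im}t|<r\}\cup\{t:|t|<r\}$. **Condition.** There are functions $\Psi_k(t,\xi)$, $0\le k\le n-2$, and constants $d'>0$, $c>0$, $\rho>0$, $\sigma'\ge0$ such that (i) $\Psi_k$ is analytic on $U(\mathfrak a_nd')\times\Delta$; (ii) $|\Psi_k(t,\xi)|\le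 c\,e^{\sigma'\operatorname{Re}t}/(1+|\xi|^{1+\rho})$ on $U(\mathfrak a_nd')\times\Delta$; (iii) $\psi_k(u,\xi)=\delta_{0,k}+\int_0^{+\infty}e^{-ut}\Psi_k(t,\xi)\,dt$ for $\operatorname{Re}u>\sigma'$, $\xi\in\Delta$. For $0\le j,\ell\le n-1$, $\ell\ne j$, let $\theta_{j,\ell}\equiv-\arg(e^{2\pi i\ell/n}-e^{2\pi ij/n})$ modulo $2\pi$, chosen so that $\max_{\ell\ne j}\theta_{j,\ell}-\min_{\ell\ne j}\theta_{j,\ell}=\frac{n-2}{n}\pi$ for each $j$, and let $\theta_j=\frac12(\min_{\ell\ne j}\theta_{j,\ell}+\max_{\ell\ne j}\theta_{j,\ell})$. For $d>0$, $\Gamma_j(d)$ denotes any non-empty subdomain of $\Delta$ all of whose points have distance at least $d$ from the boundary of $\Delta$ (that is, the disc of radius $d$ about the point lies in $\Delta$ as a one-sheeted unramified disc) and which contains, with each of its points $\xi$, the paths $\xi+te^{i\theta_{j,\ell}}$, $t\ge0$, for all $\ell\ne j$. Let $\mathscr P_j(\xi)$ be the path $\xi+te^{i\theta_j}$, $t\ge0$.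 Put $$X_j(\xi)=-\frac1n\int_{\mathscr P_j(\xi)}\sum_{k=0}^{n-2}e^{2\pi ij(k+1)/n}\psi_{k,1}(t)\,dt,$$ let $\mathtt B_p=\mathtt B_p(X_j',\dots,X_j^{(p)})$, where the complete exponential Bell polynomials are given by $\mathtt B_0=1$, $\mathtt B_{p+1}(x_1,\dots,x_{p+1})=\sum_{q=0}^p\binom pq x_{q+1}\mathtt B_{p-q}(x_1,\dots,x_{p-q})$, and define $\mathsf A_{j,0}=1$ and, for $m\ge1$, $$\begin{aligned}\mathsf A_{j,m}(\xi)=&\frac1n\sum_{p=2}^{\min(n,m+1)}\binom npe^{2\pi ij(n-p+1)/n}\sum_{r=0}^p\binom pr\int_{\mathscr P_j(\xi)}\mathtt B_{p-r}\,\mathsf A_{j,m-p+1}^{(r)}(t)\,dt\\&-\frac1n\sum_{k=0}^{n-2}\sum_{p=1}^{\min(m,k)}\binom kpe^{2\pi ij(k-p+1)/n}\sum_{r=0}^p\binom pr\int_{\mathscr P_j(\xi)}\mathtt B_{p-r}\,\psi_{k,1}(t)\,\mathsf A_{j,m-p}^{(r)}(t)\,dt\\&-\frac1n\sum_{k=0}^{n-2}\sum_{q=0}^{m-1}\sum_{p=0}^{\min(k,q)}\binom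 kpe^{2\pi ij(k-p+1)/n}\sum_{r=0}^p\binom pr\int_{\mathscr P_j(\xi)}\mathtt B_{p-r}\,\psi_{k,m-q+1}(t)\,\mathsf A_{j,q-p}^{(r)}(t)\,dt.\end{aligned}$$ **Proposition.** Let $0<d<d'$ and suppose that the Condition holds. Then there is a positive integer $L$, independent of $\xi$, $j$, $m$, $s$ and of the choice of the domains $\Gamma_j(d)$, such that for each $0\le j\le n-1$ and each domain $\Gamma_j(d)$: for every $\xi\in\Gamma_j(d)$ the path $\mathscr P_j(\xi)$ lies in $\Gamma_j(d)$ and all the integrals above converge absolutely, the functions $X_j$ and $\mathsf A_{j,m}$ are analytic in $\Gamma_j(d)$, and for all integers $m,s\ge1$ and all $\xi\in\Gamma_j(d)$ $$|\mathsf A_{j,m}(\xi)|\le\frac1{\mathfrak a_n^{m-1}}\frac1{d^m}\frac{(m+L+1)!}{(\max(1,\operatorname{Re}(\xi e^{-i\theta_j})))^\rho},$$ $$\left|\frac{d^s\mathsf A_{j,m}(\xi)}{d\xi^s}\right|\le\frac1{\mathfrak a_n^{m-1}}\frac1{d^{m+s-1}}\frac{(m+L+s)!}{1+|\xi|^{1+\rho}}.$$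 -/

import Mathlib

open scoped Topology

noncomputable section

namespace BorelGevrey

/-! The constant `𝔞ₙ`. -/

/-- For `n ≥ 2` the equation `(1 + a)ⁿ = 1 + 2na` has exactly one positive solution. -/
theorem existsUnique_aConst {n : ℕ} (hn : 2 ≤ n) :
    ∃! a : ℝ, 0 < a ∧ (1 + a) ^ n = 1 + 2 * n * a := by
  have hn0 : (0 : ℝ) < n := by positivity
  have hconv : StrictConvexOn ℝ (Set.Ici (0 : ℝ)) (fun x : ℝ => x ^ n) := strictConvexOn_pow hn
  -- existence
  have h1 : (1 + 1 / (2 * (n : ℝ))) ^ n ≤ 2 := by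
    have h2 : (1 + 1 / (2 * (n : ℝ))) ^ n ≤ Real.exp (1 / 2) := by
      calc (1 + 1 / (2 * (n : ℝ))) ^ n ≤ (Real.exp (1 / (2 * (n : ℝ)))) ^ n := by
            gcongr
            linarith [Real.add_one_le_exp (1 / (2 * (n : ℝ)))]
        _ = Real.exp (1 / 2) := by
            rw [← Real.exp_nat_mul]
            congr 1
            field_simp
    have h3 : Real.exp (1 / 2) ≤ 2 := by
      have h4 : Real.exp (1 / 2) * Real.exp (1 / 2) = Real.exp 1 := by
        rw [← Real.exp_add]; norm_num
      nlinarith [Real.exp_one_lt_d9, Real.exp_pos (1 / 2)]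
    linarith
  have h5 : ∀ k : ℕ, (1 : ℝ) + 4 * ((k + 2 : ℕ) : ℝ) ≤ 3 ^ (k + 2) := by
    intro k
    induction k with
    | zero => norm_num
    | succ k ih =>
      have h6 : (3 : ℝ) ^ (k + 1 + 2) = 3 * 3 ^ (k + 2) := by ring
      rw [h6]
      push_cast at ih ⊢
      have : (0 : ℝ) ≤ k := by positivity
      linarith
  have h7 : (1 : ℝ) + 4 * n ≤ 3 ^ n := by
    have := h5 (n - 2)
    rwa [Nat.sub_add_cancel hn] at this
  have hle : 1 / (2 * (n : ℝ)) ≤ 2 := by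
    have h2n : (2 : ℝ) ≤ n := by exact_mod_cast hn
    rw [div_le_iff₀ (by positivity)]
    linarith
  have hcont : ContinuousOn (fun x : ℝ => (1 + x) ^ n - (1 + 2 * n * x))
      (Set.Icc (1 / (2 * (n : ℝ))) 2) := by fun_prop
  have hmem : (0 : ℝ) ∈ Set.Icc
      ((fun x : ℝ => (1 + x) ^ n - (1 + 2 * n * x)) (1 / (2 * (n : ℝ))))
      ((fun x : ℝ => (1 + x) ^ n - (1 + 2 * n * x)) 2) := by
    constructor
    · have : 2 * (n : ℝ) * (1 / (2 * (n : ℝ))) = 1 := by field_simp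
      simp only [this]
      linarith
    · have h8 : (1 + 2 : ℝ) ^ n = 3 ^ n := by norm_num
      simp only [h8]
      linarith
  obtain ⟨a, ha, hfa⟩ := intermediate_value_Icc hle hcont hmem
  have hpos : 0 < a := lt_of_lt_of_le (by positivity) ha.1
  -- uniqueness
  have huniq : ∀ x y : ℝ, 0 < x → x < y → (1 + x) ^ n = 1 + 2 * n * x →
      (1 + y) ^ n = 1 + 2 * n * y → False := by
    intro x y hx hxy hxe hye
    have hy : 0 < y := hx.trans hxy
    have h0a : (1 : ℝ) ∈ Set.Ici (0 : ℝ) := by simp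
    have h0b : 1 + y ∈ Set.Ici (0 : ℝ) := by simp only [Set.mem_Ici]; linarith
    have h0c : (1 : ℝ) ≠ 1 + y := by linarith
    have h0d : 0 < 1 - x / y := by rw [sub_pos, div_lt_one hy]; exact hxy
    have h9 := hconv.2 h0a h0b h0c h0d (div_pos hx hy) (by ring)
    have h10 : (1 - x / y) • (1 : ℝ) + (x / y) • (1 + y) = 1 + x := by
      simp only [smul_eq_mul]; field_simp; ring
    rw [h10] at h9
    simp only [smul_eq_mul, one_pow, hxe, hye] at h9
    have h11 : (1 - x / y) * 1 + x / y * (1 + 2 * n * y) = 1 + 2 * n * x := by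
      field_simp; ring
    linarith
  refine ⟨a, ⟨hpos, by simpa [sub_eq_zero] using hfa⟩, ?_⟩
  rintro b ⟨hb, hbe⟩
  have hae : (1 + a) ^ n = 1 + 2 * n * a := by simpa [sub_eq_zero] using hfa
  rcases lt_trichotomy b a with h | h | h
  · exact (huniq b a hb h hbe hae).elim
  · exact h
  · exact (huniq a b hpos h hae hbe).elim

/-- `𝔞ₙ`: the unique positive solution of `(1 + a)ⁿ = 1 + 2na` (for `n ≥ 2`). -/
def aConst (n : ℕ) : ℝ := sSup {a : ℝ | 0 < a ∧ (1 + a) ^ n = 1 + 2 * n * a}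

theorem aConst_spec {n : ℕ} (hn : 2 ≤ n) :
    0 < aConst n ∧ (1 + aConst n) ^ n = 1 + 2 * n * aConst n := by
  obtain ⟨a, ha, hu⟩ := existsUnique_aConst hn
  have hs : {a : ℝ | 0 < a ∧ (1 + a) ^ n = 1 + 2 * n * a} = {a} :=
    Set.eq_singleton_iff_unique_mem.2 ⟨ha, fun b hb => hu b hb⟩
  have : aConst n = a := by rw [aConst, hs, csSup_singleton]
  rw [this]
  exact ha

/-- `U(r)`: the points at distance less than `r` from the half-line `[0, ∞)`. -/
def tube (r : ℝ) : Set ℂ := {t : ℂ | 0 < t.re ∧ |t.im| < r} ∪ Metric.ball 0 r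

/-- The root of unity `e^{2πije/n}`. -/
def rootExp (n j e : ℕ) : ℂ :=
  Complex.exp (2 * Real.pi * Complex.I * (j : ℂ) * (e : ℂ) / (n : ℂ))

/-- The complete exponential Bell polynomials `B_p(x₁, …, x_p)`, through
`B₀ = 1`, `B_{p+1} = ∑_{q ≤ p} C(p,q) x_{q+1} B_{p-q}`. -/
def completeBell (x : ℕ → ℂ) : ℕ → ℂ
  | 0 => 1
  | p + 1 => ∑ q : Fin (p + 1), (p.choose q : ℂ) * x (q + 1) * completeBell x (p - q)

/-! Calculus on a surface `G` spread over the complex plane: `G` is a Hausdorff space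
with a local homeomorphism `ξ : G → ℂ`, the (global, possibly not injective) coordinate.
A plane domain is the case where `ξ` is injective. -/

section Surface

variable {G : Type*} [TopologicalSpace G] {ξ : G → ℂ}

/-- A local inverse of the coordinate `ξ` near `ξ x`, sending `ξ x` to `x`. Only its germ at
`ξ x` is ever used, and that germ is unique. -/
def localInv (hξ : IsLocalHomeomorph ξ) (x : G) : ℂ → G := (hξ x).choose.symm

/-- `f` is analytic at the point `x` (in the coordinate `ξ`). -/
def AnalyticAtPt (hξ : IsLocalHomeomorph ξ) (f : G → ℂ) (x : G) : Prop :=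
  AnalyticAt ℂ (fun w => f (localInv hξ x w)) (ξ x)

/-- The derivative `d^s f / dξ^s` at the point `x`. -/
def dxi (hξ : IsLocalHomeomorph ξ) (s : ℕ) (f : G → ℂ) (x : G) : ℂ :=
  iteratedDeriv s (fun w => f (localInv hξ x w)) (ξ x)

/-- `γ` is the infinite path `[0, ∞) ∋ t ↦ x + t e^{iα}` in `G`, that is, the lift starting at `x`
of the corresponding half-line in the plane. -/
def IsRay (ξ : G → ℂ) (α : ℝ) (x : G) (γ : ℝ → G) : Prop :=
  ContinuousOn γ (Set.Ici 0) ∧ γ 0 = x ∧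
    ∀ t : ℝ, 0 ≤ t → ξ (γ t) = ξ x + t * Complex.exp (α * Complex.I)

open Classical in
/-- The path `t ↦ x + t e^{iα}` (it is unique on `[0, ∞)` when it exists, as `G` is Hausdorff). -/
def ray (ξ : G → ℂ) (α : ℝ) (x : G) : ℝ → G :=
  if h : ∃ γ : ℝ → G, IsRay ξ α x γ then h.choose else fun _ => x

/-- The integral `∫ f(t) dt` along the path `t ↦ x + t e^{iα}`. -/
def rayIntegral (ξ : G → ℂ) (α : ℝ) (f : G → ℂ) (x : G) : ℂ :=
  Complex.exp (α * Complex.I) * ∫ t in Set.Ioi (0 : ℝ), f (ray ξ α x t)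

/-- Absolute convergence of the integral of `f` along the path `t ↦ x + t e^{iα}`. -/
def RayIntegrable (ξ : G → ℂ) (α : ℝ) (f : G → ℂ) (x : G) : Prop :=
  MeasureTheory.IntegrableOn (fun t : ℝ => f (ray ξ α x t)) (Set.Ioi 0)

/-- The distance from `x` to the boundary of `Δ` is at least `d`: the disc of radius `d` about `x`
lies in `Δ` as an unramified one-sheeted disc. For `Δ` in the plane this says
that no boundary point of `Δ` is at distance less than `d` from the point `x` of `Δ`. -/
def BoundaryDistGE (ξ : G → ℂ) (Δ : Set G) (d : ℝ) (x : G) : Prop :=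
  ∃ τ : ℂ → G, ContinuousOn τ (Metric.ball (ξ x) d) ∧ τ (ξ x) = x ∧
    ∀ w ∈ Metric.ball (ξ x) d, τ w ∈ Δ ∧ ξ (τ w) = w

/-! The angles. -/

/-- An admissible choice of the angles `θ_{j,ℓ} = -arg(e^{2πiℓ/n} - e^{2πij/n})` modulo `2π`,
normalised by `max_ℓ θ_{j,ℓ} - min_ℓ θ_{j,ℓ} = (n-2)π/n`. -/
structure IsAngleChoice (n : ℕ) (θ : Fin n → Fin n → ℝ) : Prop where
  arg_eq : ∀ j l : Fin n, l ≠ j →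
    (θ j l : Real.Angle) = -((Complex.arg (rootExp n l 1 - rootExp n j 1) : ℝ) : Real.Angle)
  spread : ∀ j : Fin n,
    (⨆ l : {l : Fin n // l ≠ j}, θ j l) - (⨅ l : {l : Fin n // l ≠ j}, θ j l)
      = ((n : ℝ) - 2) / n * Real.pi

/-- `θ_j`, the mean of the smallest and the largest of the `θ_{j,ℓ}`. -/
def midAngle {n : ℕ} (θ : Fin n → Fin n → ℝ) (j : Fin n) : ℝ :=
  ((⨅ l : {l : Fin n // l ≠ j}, θ j l) + (⨆ l : {l : Fin n // l ≠ j}, θ j l)) / 2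

/-! The potentials. -/

/-- For every `x ∈ Δ` and `0 ≤ k ≤ n - 2`,
`ψ_k(u, x) ∼ δ_{0,k} + ∑_{m ≥ 1} ψ_{k,m}(x) / u^m` as `u → +∞`. -/
def HasExpansion (n : ℕ) (Δ : Set G) (ψ : ℕ → ℂ → G → ℂ) (ψc : ℕ → ℕ → G → ℂ) : Prop :=
  ∀ k < n - 1, ∀ x ∈ Δ, ∀ N : ℕ,
    (fun u : ℝ => ψ k (u : ℂ) x
        - ((if k = 0 then 1 else 0) + ∑ m ∈ Finset.Icc 1 N, ψc k m x / (u : ℂ) ^ m))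
      =o[Filter.atTop] fun u : ℝ => (u ^ N)⁻¹

/-- The potentials `ψ_k` are Borel summable in `Δ`, with Borel transforms `Ψ_k` that are
analytic on `U(𝔞ₙ d') × Δ` and satisfy the growth condition with constants `c`, `ρ`, `σ'`. -/
structure BorelCondition (n : ℕ) (hξ : IsLocalHomeomorph ξ) (Δ : Set G)
    (ψ Ψ : ℕ → ℂ → G → ℂ) (d' c ρ σ' : ℝ) : Prop where
  c_pos : 0 < c
  rho_pos : 0 < ρ
  sigma_nonneg : 0 ≤ σ'
  analytic : ∀ k < n - 1, ∀ t ∈ tube (aConst n * d'), ∀ x ∈ Δ,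
    AnalyticAt ℂ (fun p : ℂ × ℂ => Ψ k p.1 (localInv hξ x p.2)) (t, ξ x)
  growth : ∀ k < n - 1, ∀ t ∈ tube (aConst n * d'), ∀ x ∈ Δ,
    ‖Ψ k t x‖ ≤ c * (Real.exp (σ' * t.re) / (1 + ‖ξ x‖ ^ (1 + ρ)))
  laplace : ∀ k < n - 1, ∀ u : ℂ, σ' < u.re → ∀ x ∈ Δ,
    ψ k u x = (if k = 0 then 1 else 0)
      + ∫ t in Set.Ioi (0 : ℝ), Complex.exp (-u * t) * Ψ k (t : ℂ) x

/-- `Γ` is one of the domains `Γ_j(d)`. -/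
structure IsGammaDomain {n : ℕ} (ξ : G → ℂ) (Δ : Set G) (θ : Fin n → Fin n → ℝ) (j : Fin n)
    (d : ℝ) (Γ : Set G) : Prop where
  isOpen : IsOpen Γ
  isConnected : IsConnected Γ
  subset : Γ ⊆ Δ
  boundary_dist : ∀ x ∈ Γ, BoundaryDistGE ξ Δ d x
  rays : ∀ x ∈ Γ, ∀ l : Fin n, l ≠ j →
    ∃ γ : ℝ → G, IsRay ξ (θ j l) x γ ∧ ∀ t : ℝ, 0 ≤ t → γ t ∈ Γ

/-! The coefficients. In the following, `ψc k m` is `ψ_{k,m}` and `α` is the angle `θ_j`. -/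

/-- The integrand `∑_k e^{2πij(k+1)/n} ψ_{k,1}` of `X_j`. -/
def XIntegrand (n j : ℕ) (ψc : ℕ → ℕ → G → ℂ) : G → ℂ := fun y =>
  ∑ k ∈ Finset.range (n - 1), rootExp n j (k + 1) * ψc k 1 y

/-- `X_j(x) = -(1/n) ∫ ∑_k e^{2πij(k+1)/n} ψ_{k,1}(t) dt`. -/
def XFun (n j : ℕ) (ξ : G → ℂ) (α : ℝ) (ψc : ℕ → ℕ → G → ℂ) : G → ℂ := fun x =>
  -(1 / (n : ℂ)) * rayIntegral ξ α (XIntegrand n j ψc) x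

/-- `B_p(X'(y), X''(y), …, X^{(p)}(y))`. -/
def bellOf (hξ : IsLocalHomeomorph ξ) (X : G → ℂ) (p : ℕ) : G → ℂ := fun y =>
  completeBell (fun i => dxi hξ i X y) p

/-- The integrand `B_{p-r} · f · d^r g / dt^r`. -/
def recTerm (hξ : IsLocalHomeomorph ξ) (X : G → ℂ) (p r : ℕ) (f g : G → ℂ) : G → ℂ := fun y =>
  bellOf hξ X (p - r) y * f y * dxi hξ r g y

/-- The right-hand side of the recurrence for `A_{j,m}`. -/
def recRHS (n j : ℕ) (hξ : IsLocalHomeomorph ξ) (α : ℝ) (ψc : ℕ → ℕ → G → ℂ)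
    (A : ℕ → G → ℂ) (m : ℕ) (x : G) : ℂ :=
  let X := XFun n j ξ α ψc
  1 / (n : ℂ) * ∑ p ∈ Finset.Icc 2 (min n (m + 1)),
      (n.choose p : ℂ) * rootExp n j (n - p + 1) *
        ∑ r ∈ Finset.range (p + 1), (p.choose r : ℂ) *
          rayIntegral ξ α (recTerm hξ X p r (fun _ => 1) (A (m + 1 - p))) x
  - 1 / (n : ℂ) * ∑ k ∈ Finset.range (n - 1), ∑ p ∈ Finset.Icc 1 (min m k),
      (k.choose p : ℂ) * rootExp n j (k - p + 1) *
        ∑ r ∈ Finset.range (p + 1), (p.choose r : ℂ) *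
          rayIntegral ξ α (recTerm hξ X p r (ψc k 1) (A (m - p))) x
  - 1 / (n : ℂ) * ∑ k ∈ Finset.range (n - 1), ∑ q ∈ Finset.range m,
      ∑ p ∈ Finset.range (min k q + 1),
        (k.choose p : ℂ) * rootExp n j (k - p + 1) *
          ∑ r ∈ Finset.range (p + 1), (p.choose r : ℂ) *
            rayIntegral ξ α (recTerm hξ X p r (ψc k (m - q + 1)) (A (q - p))) x

theorem recRHS_congr (n j : ℕ) (hξ : IsLocalHomeomorph ξ) (α : ℝ) (ψc : ℕ → ℕ → G → ℂ)
    {A A' : ℕ → G → ℂ} (m : ℕ) (h : ∀ i, i < m → A i = A' i) (hm : 1 ≤ m) (x : G) :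
    recRHS n j hξ α ψc A m x = recRHS n j hξ α ψc A' m x := by
  unfold recRHS
  refine congrArg₂ (fun a b => a - b) (congrArg₂ (fun a b => a - b)
    (congrArg (fun z => 1 / (n : ℂ) * z) ?_) (congrArg (fun z => 1 / (n : ℂ) * z) ?_))
    (congrArg (fun z => 1 / (n : ℂ) * z) ?_)
  · refine Finset.sum_congr rfl fun p hp => ?_
    rw [Finset.mem_Icc] at hp
    rw [h (m + 1 - p) (by omega)]
  · refine Finset.sum_congr rfl fun k _ => Finset.sum_congr rfl fun p hp => ?_
    rw [Finset.mem_Icc] at hp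
    rw [h (m - p) (by omega)]
  · refine Finset.sum_congr rfl fun k _ => Finset.sum_congr rfl fun q hq =>
      Finset.sum_congr rfl fun p _ => ?_
    rw [Finset.mem_range] at hq
    rw [h (q - p) (by omega)]

/-- The coefficients `A_{j,m}`: `A_{j,0} = 1`, and the recurrence for `m ≥ 1`. The right-hand side
involves `A_{j,i}` with `i < m` only, see `coeff_eq_recRHS`. -/
def coeff (n j : ℕ) (hξ : IsLocalHomeomorph ξ) (α : ℝ) (ψc : ℕ → ℕ → G → ℂ) : ℕ → G → ℂ
  | 0 => fun _ => 1
  | m + 1 => fun x => recRHS n j hξ α ψc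
      (fun i => if _h : i < m + 1 then coeff n j hξ α ψc i else 0) (m + 1) x

theorem coeff_zero (n j : ℕ) (hξ : IsLocalHomeomorph ξ) (α : ℝ) (ψc : ℕ → ℕ → G → ℂ) :
    coeff n j hξ α ψc 0 = fun _ => 1 := by
  rw [coeff]

theorem coeff_eq_recRHS (n j : ℕ) (hξ : IsLocalHomeomorph ξ) (α : ℝ) (ψc : ℕ → ℕ → G → ℂ)
    {m : ℕ} (hm : 1 ≤ m) (x : G) :
    coeff n j hξ α ψc m x = recRHS n j hξ α ψc (coeff n j hξ α ψc) m x := by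
  obtain ⟨m, rfl⟩ : ∃ k, m = k + 1 := ⟨m - 1, by omega⟩
  have h : ∀ i, i < m + 1 →
      (if _h : i < m + 1 then coeff n j hξ α ψc i else 0) = coeff n j hξ α ψc i :=
    fun i hi => by rw [dif_pos hi]
  have h' := recRHS_congr n j hξ α ψc (m + 1) h hm x
  rw [← h']
  exact congrFun (coeff.eq_2 n j hξ α ψc m) x

/-- All integrals in the definition of `X_j(x)` and in the recurrence for `A_{j,m}(x)` converge
absolutely. -/
structure RecurrenceConverges (n j : ℕ) (hξ : IsLocalHomeomorph ξ) (α : ℝ)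
    (ψc : ℕ → ℕ → G → ℂ) (m : ℕ) (x : G) : Prop where
  X : RayIntegrable ξ α (XIntegrand n j ψc) x
  first : ∀ p ∈ Finset.Icc 2 (min n (m + 1)), ∀ r ∈ Finset.range (p + 1),
    RayIntegrable ξ α
      (recTerm hξ (XFun n j ξ α ψc) p r (fun _ => 1) (coeff n j hξ α ψc (m + 1 - p))) x
  second : ∀ k ∈ Finset.range (n - 1), ∀ p ∈ Finset.Icc 1 (min m k), ∀ r ∈ Finset.range (p + 1),
    RayIntegrable ξ α
      (recTerm hξ (XFun n j ξ α ψc) p r (ψc k 1) (coeff n j hξ α ψc (m - p))) x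
  third : ∀ k ∈ Finset.range (n - 1), ∀ q ∈ Finset.range m, ∀ p ∈ Finset.range (min k q + 1),
    ∀ r ∈ Finset.range (p + 1), RayIntegrable ξ α
      (recTerm hξ (XFun n j ξ α ψc) p r (ψc k (m - q + 1)) (coeff n j hξ α ψc (q - p))) x

end Surface

end BorelGevrey

end

namespace BorelGevrey

open Filter Finset

/-! The proof runs on Cauchy majorants: near a point, `f` is measured by a constant C and an
exponent N such that its Taylor coefficients are dominated by those of C / (1 - z/d)^N. Products
multiply constants and add exponents, and r derivatives cost N(N+1)...(N+r-1)/d^r and raise the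
exponent by r. No disc is ever shrunk, so the sharp base `aConst n * d` survives the induction.

Potentials. By Watson's lemma and uniqueness of asymptotic expansions, ψ_{k,m} is the (m-1)-st
t-derivative of Ψ_k at t = 0. Cauchy's estimate on |t| = R, where a·d < R < a·d' and a = `aConst n`,
followed by Cauchy's estimate on discs of radius d in Δ, gives ψ_{k,m+1} a majorant with exponent 1
and constant of size m!/R^m times the weight 1/(1+|ξ|^{1+ρ}) (`BorelCondition.exists_coeff_maj`).

Paths. The direction θ_j bisects the two extreme directions θ_{j,ℓ}, whose difference is less than
π, so it is a nonnegative combination of them and its rays stay in Γ (`rayClosed_midAngle`). The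
integral of a decaying function along such a ray has derivative minus the integrand
(`DecayOn.hasDerivAt`).

Induction (`CoeffBound.step`). Hence A_m' is minus the integrand of the recurrence, and the
hypothesis carried along is that A_m' has a majorant with constant Q_m (m+1)!/(a·d)^m times the
weight and exponent m+2. Only the terms A_{m+1-p}^{(p)} of the first sum reach the order (m+1)!.
They contribute C(n,p) a^{p-1}/n each, and the equation defining a says precisely that these numbers
add up to 1 over 2 ≤ p ≤ n. All other terms are of order m!, the sum over the potentials converging
geometrically because a·d < R. What remains is Q_{m-1}(m+1+E) ≤ Q_m(m+1) with a constant E. It is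
solved by Q_m = C(m+κ, κ) with κ ≥ E, a polynomial in m that L absorbs. Each term keeps a factor of
the weight, which makes the integrals converge and, integrated along the ray, gives the decay in
max(1, Re(ξe^{-iθ_j})). -/

/-! Majorants `C / (1 - z / d) ^ N` for the Taylor expansion of a function at a point. -/

/-- `F` is analytic at `z` and its Taylor coefficients at `z` are dominated by those of
`C / (1 - (w - z) / d) ^ N`. -/
structure MajAt (d : ℝ) (F : ℂ → ℂ) (z : ℂ) (C : ℝ) (N : ℕ) : Prop where
  analytic : AnalyticAt ℂ F z
  bound : ∀ i : ℕ, ‖iteratedDeriv i F z‖ ≤ C * (N.ascFactorial i / d ^ i)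

/-- Coefficient comparison in (1-z)^{-N} (1-z)^{-M} = (1-z)^{-(N+M)}; this is why exponents of
majorants add under multiplication. -/
theorem ascFactorial_vandermonde (N M k : ℕ) :
    ∑ i ∈ range (k + 1), (k.choose i : ℝ) * ((N.ascFactorial i : ℝ) * M.ascFactorial (k - i)) =
      (N + M).ascFactorial k := by
  induction k with
  | zero => simp
  | succ k ih =>
    rw [sum_choose_succ_mul (fun i j => (N.ascFactorial i : ℝ) * M.ascFactorial j),
      Nat.ascFactorial_succ, ← sum_add_distrib]
    push_cast
    rw [← ih, mul_sum]
    refine sum_congr rfl fun i hi => ?_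
    have hik : i ≤ k := Nat.lt_succ_iff.1 (mem_range.1 hi)
    rw [Nat.sub_add_comm hik, Nat.ascFactorial_succ, Nat.ascFactorial_succ]
    push_cast [Nat.cast_sub hik]
    ring

theorem ascFactorial_mono {N M : ℕ} (h : N ≤ M) (i : ℕ) : N.ascFactorial i ≤ M.ascFactorial i := by
  induction i with
  | zero => simp
  | succ i ih =>
    rw [Nat.ascFactorial_succ, Nat.ascFactorial_succ]
    exact Nat.mul_le_mul (by omega) ih

namespace MajAt

variable {d : ℝ} {F F' : ℂ → ℂ} {z : ℂ} {C C' : ℝ} {N N' : ℕ}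

theorem congr (h : MajAt d F z C N) (hF : F =ᶠ[𝓝 z] F') : MajAt d F' z C N :=
  ⟨h.analytic.congr hF, fun i => by rw [← hF.iteratedDeriv_eq i]; exact h.bound i⟩

theorem norm_le (h : MajAt d F z C N) : ‖F z‖ ≤ C := by simpa using h.bound 0

theorem nonneg (h : MajAt d F z C N) : 0 ≤ C := (norm_nonneg _).trans h.norm_le

theorem mono (hd : 0 < d) (h : MajAt d F z C N) (hC : C ≤ C') (hN : N ≤ N') :
    MajAt d F z C' N' := by
  refine ⟨h.analytic, fun i => (h.bound i).trans ?_⟩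
  have h0 := h.nonneg.trans hC
  have : (N.ascFactorial i : ℝ) ≤ N'.ascFactorial i := by exact_mod_cast ascFactorial_mono hN i
  gcongr

theorem add (h : MajAt d F z C N) (h' : MajAt d F' z C' N) :
    MajAt d (fun w => F w + F' w) z (C + C') N := by
  refine ⟨h.analytic.add h'.analytic, fun i => ?_⟩
  rw [iteratedDeriv_fun_add h.analytic.contDiffAt h'.analytic.contDiffAt, add_mul]
  exact (norm_add_le _ _).trans (add_le_add (h.bound i) (h'.bound i))

theorem const_mul (h : MajAt d F z C N) (b : ℂ) :
    MajAt d (fun w => b * F w) z (‖b‖ * C) N := by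
  refine ⟨analyticAt_const.mul h.analytic, fun i => ?_⟩
  rw [iteratedDeriv_const_mul_field, norm_mul, mul_assoc]
  exact mul_le_mul_of_nonneg_left (h.bound i) (norm_nonneg _)

theorem neg (h : MajAt d F z C N) : MajAt d (fun w => -F w) z C N := by
  simpa using h.const_mul (-1)

theorem sub (h : MajAt d F z C N) (h' : MajAt d F' z C' N) :
    MajAt d (fun w => F w - F' w) z (C + C') N := by
  simpa [sub_eq_add_neg] using h.add h'.neg

theorem zero (d : ℝ) (z : ℂ) (N : ℕ) : MajAt d (fun _ => 0) z 0 N :=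
  ⟨analyticAt_const, fun i => by rw [iteratedDeriv_fun_const_zero]; simp⟩

theorem sum {ι : Type*} {s : Finset ι} {F : ι → ℂ → ℂ} {C : ι → ℝ}
    (h : ∀ i ∈ s, MajAt d (F i) z (C i) N) :
    MajAt d (fun w => ∑ i ∈ s, F i w) z (∑ i ∈ s, C i) N := by
  classical
  induction s using Finset.induction_on with
  | empty => simpa using zero d z N
  | insert a s ha ih =>
    simp only [sum_insert ha]
    exact (h a (mem_insert_self _ _)).add (ih fun i hi => h i (mem_insert_of_mem hi))

theorem one (d : ℝ) (z : ℂ) (N : ℕ) (hd : 0 < d) : MajAt d (fun _ => 1) z 1 N := by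
  refine ⟨analyticAt_const, fun i => ?_⟩
  rw [iteratedDeriv_const]
  split_ifs with h
  · simp [h]
  · simp; positivity

theorem mul (hd : 0 < d) (h : MajAt d F z C N) (h' : MajAt d F' z C' N') :
    MajAt d (fun w => F w * F' w) z (C * C') (N + N') := by
  refine ⟨h.analytic.mul h'.analytic, fun k => ?_⟩
  rw [iteratedDeriv_fun_mul h.analytic.contDiffAt h'.analytic.contDiffAt,
    ← ascFactorial_vandermonde, sum_div, mul_sum]
  refine norm_sum_le_of_le _ fun i hi => ?_
  have hik : i ≤ k := Nat.lt_succ_iff.1 (mem_range.1 hi)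
  have hC := h.nonneg
  have hC' := h'.nonneg
  rw [norm_mul, norm_mul, Complex.norm_natCast]
  calc (k.choose i : ℝ) * ‖iteratedDeriv i F z‖ * ‖iteratedDeriv (k - i) F' z‖
      ≤ (k.choose i : ℝ) * (C * (N.ascFactorial i / d ^ i)) *
        (C' * (N'.ascFactorial (k - i) / d ^ (k - i))) := by
        gcongr
        · exact h.bound i
        · exact h'.bound (k - i)
    _ = _ := by
        obtain ⟨l, rfl⟩ := Nat.exists_eq_add_of_le hik
        rw [Nat.add_sub_cancel_left, pow_add]
        field_simp

theorem iteratedDeriv (h : MajAt d F z C N) (r : ℕ) :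
    MajAt d (iteratedDeriv r F) z (C * (N.ascFactorial r / d ^ r)) (N + r) := by
  refine ⟨?_, fun i => ?_⟩
  · rw [iteratedDeriv_eq_iterate]
    exact h.analytic.iterated_deriv r
  · have h1 : _root_.iteratedDeriv i (_root_.iteratedDeriv r F) =
        _root_.iteratedDeriv (r + i) F := by
      rw [iteratedDeriv_eq_iterate, iteratedDeriv_eq_iterate, iteratedDeriv_eq_iterate,
        ← Function.iterate_add_apply, add_comm]
    rw [h1]
    refine (h.bound (r + i)).trans (le_of_eq ?_)
    rw [← Nat.ascFactorial_mul_ascFactorial, pow_add]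
    push_cast
    ring

end MajAt

/-! Local inverses of the coordinate. -/

section Surface

variable {G : Type*} [TopologicalSpace G] {ξ : G → ℂ} (hξ : IsLocalHomeomorph ξ)

/-- The function `f` in the coordinate `ξ` near `x`. -/
noncomputable def germ (f : G → ℂ) (x : G) : ℂ → ℂ := fun w => f (localInv hξ x w)

theorem localInv_self (x : G) : localInv hξ x (ξ x) = x := by
  have h := (hξ x).choose_spec
  have h2 := (hξ x).choose.left_inv h.1
  rwa [← h.2] at h2

theorem eventually_localInv (x : G) : ∀ᶠ w in 𝓝 (ξ x),
    ξ (localInv hξ x w) = w ∧ ContinuousAt (localInv hξ x) w := by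
  have h := (hξ x).choose_spec
  have ht : ξ x ∈ (hξ x).choose.target := by
    have := (hξ x).choose.map_source h.1
    rwa [← h.2] at this
  filter_upwards [(hξ x).choose.open_target.mem_nhds ht] with w hw
  refine ⟨?_, (hξ x).choose.continuousAt_symm hw⟩
  have := (hξ x).choose.right_inv hw
  rwa [← h.2] at this

theorem continuousAt_localInv (x : G) : ContinuousAt (localInv hξ x) (ξ x) :=
  (eventually_localInv hξ x).self_of_nhds.2

theorem tendsto_localInv (x : G) : Tendsto (localInv hξ x) (𝓝 (ξ x)) (𝓝 x) := by
  have := continuousAt_localInv hξ x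
  rwa [ContinuousAt, localInv_self] at this

theorem eventually_eq_localInv {T : Type*} {l : Filter T} {σ : T → G} {x : G}
    (h : Tendsto σ l (𝓝 x)) : ∀ᶠ t in l, σ t = localInv hξ x (ξ (σ t)) := by
  have hx := (hξ x).choose_spec
  filter_upwards [h ((hξ x).choose.open_source.mem_nhds hx.1)] with t ht
  have := (hξ x).choose.left_inv ht
  have h2 : ξ (σ t) = (hξ x).choose (σ t) := congrFun hx.2 (σ t)
  rw [h2]
  exact this.symm

theorem localInv_localInv (x : G) : ∀ᶠ w in 𝓝 (ξ x),
    localInv hξ (localInv hξ x w) =ᶠ[𝓝 w] localInv hξ x := by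
  filter_upwards [eventually_localInv hξ x, (eventually_localInv hξ x).eventually_nhds]
    with w hw hw'
  filter_upwards [eventually_eq_localInv hξ hw.2, hw'] with v hv hv'
  rw [hv'.1] at hv
  exact hv.symm

/-- Local inverses chosen at nearby points define the same germ. All derivatives near `x` can
therefore be taken in the single chart at `x`, although `dxi` uses a different chart at each point.
-/
theorem germ_localInv (f : G → ℂ) (x : G) : ∀ᶠ w in 𝓝 (ξ x),
    germ hξ f (localInv hξ x w) =ᶠ[𝓝 w] germ hξ f x := by
  filter_upwards [localInv_localInv hξ x] with w hw
  filter_upwards [hw] with v hv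
  simp only [germ, hv]

theorem germ_dxi (r : ℕ) (f : G → ℂ) (x : G) :
    germ hξ (dxi hξ r f) x =ᶠ[𝓝 (ξ x)] iteratedDeriv r (germ hξ f x) := by
  filter_upwards [germ_localInv hξ f x, eventually_localInv hξ x] with w hw hw'
  have := hw.iteratedDeriv_eq r
  rw [← this]
  change iteratedDeriv r (germ hξ f (localInv hξ x w)) (ξ (localInv hξ x w)) = _
  rw [hw'.1]

theorem germ_self (f : G → ℂ) (x : G) : germ hξ f x (ξ x) = f x := by
  simp only [germ, localInv_self]

/-- The majorant relation for functions on the surface. -/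
def Maj (d : ℝ) (f : G → ℂ) (x : G) (C : ℝ) (N : ℕ) : Prop := MajAt d (germ hξ f x) (ξ x) C N

variable {hξ} {d : ℝ} {f g : G → ℂ} {x : G} {C C' : ℝ} {N N' : ℕ}

theorem Maj.norm_le (h : Maj hξ d f x C N) : ‖f x‖ ≤ C := by
  have := MajAt.norm_le h
  rwa [germ_self] at this

theorem Maj.mono (hd : 0 < d) (h : Maj hξ d f x C N) (hC : C ≤ C') (hN : N ≤ N') :
    Maj hξ d f x C' N' := MajAt.mono hd h hC hN

theorem Maj.mul (hd : 0 < d) (h : Maj hξ d f x C N) (h' : Maj hξ d g x C' N') :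
    Maj hξ d (fun y => f y * g y) x (C * C') (N + N') := MajAt.mul hd h h'

theorem Maj.dxi (h : Maj hξ d f x C N) (r : ℕ) :
    Maj hξ d (dxi hξ r f) x (C * (N.ascFactorial r / d ^ r)) (N + r) :=
  (MajAt.iteratedDeriv h r).congr (germ_dxi hξ r f x).symm

theorem dxi_zero (f : G → ℂ) : dxi hξ 0 f = f := by
  funext x
  simp only [BorelGevrey.dxi, iteratedDeriv_zero, localInv_self]

theorem dxi_dxi (r s : ℕ) (f : G → ℂ) : dxi hξ r (dxi hξ s f) = dxi hξ (r + s) f := by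
  funext x
  refine ((germ_dxi hξ s f x).iteratedDeriv_eq r).trans ?_
  rw [iteratedDeriv_eq_iterate, iteratedDeriv_eq_iterate, ← Function.iterate_add_apply,
    ← iteratedDeriv_eq_iterate]
  rfl

theorem Maj.congr_of_mem {Γ : Set G} (hΓ : IsOpen Γ) (hx : x ∈ Γ) (hfg : ∀ y ∈ Γ, f y = g y)
    (h : Maj hξ d f x C N) : Maj hξ d g x C N := by
  refine MajAt.congr h ?_
  filter_upwards [tendsto_localInv hξ x (hΓ.mem_nhds hx)] with w hw
  exact hfg _ hw

end Surface

end BorelGevrey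

namespace BorelGevrey

open Filter Finset

/-! Rays. -/

section Rays

variable {G : Type*} [TopologicalSpace G] {ξ : G → ℂ}

theorem isRay_ray {α : ℝ} {x : G} (h : ∃ γ : ℝ → G, IsRay ξ α x γ) :
    IsRay ξ α x (ray ξ α x) := by
  rw [ray, dif_pos h]
  exact h.choose_spec

/-- The set `Γ` contains with each of its points the ray in the direction `α`. -/
def RayClosed (ξ : G → ℂ) (α : ℝ) (Γ : Set G) : Prop :=
  ∀ x ∈ Γ, ∃ γ : ℝ → G, IsRay ξ α x γ ∧ ∀ t : ℝ, 0 ≤ t → γ t ∈ Γ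

theorem RayClosed.isRay {α : ℝ} {Γ : Set G} (h : RayClosed ξ α Γ) {x : G} (hx : x ∈ Γ) :
    IsRay ξ α x (ray ξ α x) :=
  isRay_ray ((h x hx).imp fun _ h => h.1)

theorem hasDerivAt_germ (hξ : IsLocalHomeomorph ξ) {f : G → ℂ} {x : G}
    (hf : AnalyticAtPt hξ f x) : HasDerivAt (germ hξ f x) (dxi hξ 1 f x) (ξ x) := by
  rw [dxi, iteratedDeriv_one]
  exact hf.differentiableAt.hasDerivAt

theorem continuousAt_of_analyticAtPt (hξ : IsLocalHomeomorph ξ) {f : G → ℂ} {x : G}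
    (hf : AnalyticAtPt hξ f x) : ContinuousAt f x := by
  have h1 : ContinuousAt (fun y => germ hξ f x (ξ y)) x :=
    ContinuousAt.comp (g := germ hξ f x) hf.continuousAt hξ.continuous.continuousAt
  refine h1.congr ?_
  filter_upwards [eventually_eq_localInv hξ (tendsto_id (x := 𝓝 x))] with y hy
  simp only [id] at hy
  simp only [germ]
  rw [← hy]

variable [T2Space G]

theorem IsRay.eqOn (hξ : IsLocalHomeomorph ξ) {α : ℝ} {x : G} {γ γ' : ℝ → G}
    (h : IsRay ξ α x γ) (h' : IsRay ξ α x γ') : Set.EqOn γ γ' (Set.Ici 0) := by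
  refine (T2Space.isSeparatedMap ξ).eqOn_of_comp_eqOn hξ.isLocallyInjective
    (convex_Ici (0 : ℝ)).isPreconnected h.1 h'.1 ?_ (a := 0) Set.self_mem_Ici
    (h.2.1.trans h'.2.1.symm)
  intro t ht
  simp only [Function.comp_apply, h.2.2 t ht, h'.2.2 t ht]

theorem RayClosed.ray_mem (hξ : IsLocalHomeomorph ξ) {α : ℝ} {Γ : Set G} (h : RayClosed ξ α Γ)
    {x : G} (hx : x ∈ Γ) {t : ℝ} (ht : 0 ≤ t) : ray ξ α x t ∈ Γ := by
  obtain ⟨γ, hγ, hm⟩ := h x hx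
  rw [(h.isRay hx).eqOn hξ hγ ht]
  exact hm t ht

/-- Travel along the α-ray for a time s, then along the β-ray for the same time: the end point lies
over the bisecting half-line and never leaves `Γ`. Only continuity of the end point in s is at
stake, and the lifting property of local homeomorphisms supplies it. -/
theorem RayClosed.of_combination (hξ : IsLocalHomeomorph ξ) {α β δ c : ℝ} {Γ : Set G}
    (hα : RayClosed ξ α Γ) (hβ : RayClosed ξ β Γ) (hc : 0 ≤ c)
    (h : Complex.exp (δ * Complex.I) =
      c * (Complex.exp (α * Complex.I) + Complex.exp (β * Complex.I))) :
    RayClosed ξ δ Γ := by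
  intro x hx
  set γ : ℝ → G := fun s => ray ξ α x (max s 0) with hγ
  have hγm : ∀ s, γ s ∈ Γ := fun s => hα.ray_mem hξ hx (le_max_right _ _)
  have hγc : Continuous γ :=
    (hα.isRay hx).1.comp_continuous (by fun_prop) fun s => Set.mem_Ici.2 (le_max_right _ _)
  have hξγ : ∀ s, ξ (γ s) = ξ x + (max s 0 : ℝ) * Complex.exp (α * Complex.I) :=
    fun s => (hα.isRay hx).2.2 _ (le_max_right _ _)
  -- The first variable runs through the fraction of the β-ray already travelled, so that `g` is the
  -- α-ray at 0 and the wanted path at 1. The truncation `max p.2 0` makes everything defined for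
  -- all real times.
  set g : unitInterval × ℝ → G := fun p => ray ξ β (γ p.2) (p.1 * max p.2 0) with hg
  have hnn : ∀ p : unitInterval × ℝ, (0 : ℝ) ≤ p.1 * max p.2 0 :=
    fun p => mul_nonneg p.1.2.1 (le_max_right _ _)
  have hgc : Continuous g := by
    refine hξ.continuous_lift (T2Space.isSeparatedMap ξ)
      ⟨fun p : unitInterval × ℝ => ξ x + (max p.2 0 : ℝ) * Complex.exp (α * Complex.I) +
        ((p.1 * max p.2 0 : ℝ) : ℂ) * Complex.exp (β * Complex.I), by fun_prop⟩ ?_ ?_ ?_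
    · funext p
      simp only [Function.comp_apply, ContinuousMap.coe_mk, hg]
      rw [(hβ.isRay (hγm p.2)).2.2 _ (hnn p), hξγ]
    · have : (fun s : ℝ => g (0, s)) = γ := by
        funext s
        simp only [hg, Set.Icc.coe_zero, zero_mul]
        exact (hβ.isRay (hγm s)).2.1
      rw [this]
      exact hγc
    · intro s
      exact (hβ.isRay (hγm s)).1.comp_continuous (by fun_prop) fun t => hnn (t, s)
  refine ⟨fun t => g (1, c * t), ⟨by fun_prop, ?_, ?_⟩, ?_⟩
  · simp only [hg, hγ, mul_zero, max_self]
    rw [(hβ.isRay (hα.ray_mem hξ hx le_rfl)).2.1, (hα.isRay hx).2.1]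
  · intro t ht
    simp only [hg]
    rw [(hβ.isRay (hγm _)).2.2 _ (hnn (1, c * t)), hξγ, h, max_eq_left (by positivity)]
    simp only [Set.Icc.coe_one]
    push_cast
    ring
  · intro t ht
    exact hβ.ray_mem hξ (hγm _) (hnn (1, c * t))

theorem rayClosed_midAngle (hξ : IsLocalHomeomorph ξ) {n : ℕ} (hn : 2 ≤ n) {Δ Γ : Set G}
    {θ : Fin n → Fin n → ℝ} (hθ : IsAngleChoice n θ) {j : Fin n} {d : ℝ}
    (hΓ : IsGammaDomain ξ Δ θ j d Γ) : RayClosed ξ (midAngle θ j) Γ := by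
  have : Nontrivial (Fin n) := Fin.nontrivial_iff_two_le.2 hn
  obtain ⟨l0, hl0⟩ := exists_ne j
  have : Nonempty {l : Fin n // l ≠ j} := ⟨⟨l0, hl0⟩⟩
  obtain ⟨l1, h1⟩ := exists_eq_ciInf_of_finite (f := fun l : {l : Fin n // l ≠ j} => θ j l)
  obtain ⟨l2, h2⟩ := exists_eq_ciSup_of_finite (f := fun l : {l : Fin n // l ≠ j} => θ j l)
  have hs := hθ.spread j
  rw [← h1, ← h2] at hs
  have hmid : midAngle θ j = (θ j l1 + θ j l2) / 2 := by rw [midAngle, ← h1, ← h2]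
  rw [hmid]
  set α := θ j l1
  set β := θ j l2
  have hn' : (2 : ℝ) ≤ n := by exact_mod_cast hn
  have hpi := Real.pi_pos
  have hfrac : ((n : ℝ) - 2) / n < 1 := by rw [div_lt_one (by linarith)]; linarith
  have hfrac0 : 0 ≤ ((n : ℝ) - 2) / n := div_nonneg (by linarith) (by linarith)
  -- The spread (n-2)π/n is less than π, so the half-angle lies in [0, π/2) and the bisector is a
  -- positive multiple of the sum of the two unit vectors.
  have hcos : 0 < Real.cos ((β - α) / 2) := by
    apply Real.cos_pos_of_mem_Ioo
    constructor <;> nlinarith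
  refine RayClosed.of_combination hξ (α := α) (β := β) (c := (2 * Real.cos ((β - α) / 2))⁻¹)
    (fun x hx => hΓ.rays x hx l1 l1.2) (fun x hx => hΓ.rays x hx l2 l2.2) (by positivity) ?_
  have hc : Complex.cos ((β - α) / 2 : ℝ) ≠ 0 := by
    rw [← Complex.ofReal_cos]
    exact_mod_cast hcos.ne'
  have e1 : Complex.exp (α * Complex.I) = Complex.exp (((α + β) / 2 : ℝ) * Complex.I) *
      Complex.exp (-((β - α) / 2 : ℝ) * Complex.I) := by
    rw [← Complex.exp_add]; congr 1; push_cast; ring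
  have e2 : Complex.exp (β * Complex.I) = Complex.exp (((α + β) / 2 : ℝ) * Complex.I) *
      Complex.exp (((β - α) / 2 : ℝ) * Complex.I) := by
    rw [← Complex.exp_add]; congr 1; push_cast; ring
  rw [e1, e2, ← mul_add, add_comm (Complex.exp (-_ * _)), ← Complex.two_cos]
  rw [Complex.ofReal_inv, Complex.ofReal_mul, Complex.ofReal_cos, Complex.ofReal_ofNat]
  field_simp

/-- A point of the ray at a fixed time depends continuously on the starting point. The family of
rays lifts a continuous family of segments in the plane, hence is jointly continuous by lifting; one
radius `ε` serves all times. -/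
theorem continuousAt_ray_localInv (hξ : IsLocalHomeomorph ξ) {α : ℝ} {Γ : Set G}
    (hΓo : IsOpen Γ) (hΓ : RayClosed ξ α Γ) {x : G} (hx : x ∈ Γ) :
    ∃ ε > 0, ∀ w ∈ Metric.ball (ξ x) ε, localInv hξ x w ∈ Γ ∧ ξ (localInv hξ x w) = w ∧
      ∀ t : ℝ, 0 ≤ t → ContinuousAt (fun v => ray ξ α (localInv hξ x v) t) w := by
  have hev : ∀ᶠ w in 𝓝 (ξ x), localInv hξ x w ∈ Γ ∧ ξ (localInv hξ x w) = w ∧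
      ContinuousAt (localInv hξ x) w := by
    filter_upwards [tendsto_localInv hξ x (hΓo.mem_nhds hx), eventually_localInv hξ x] with w h1 h2
    exact ⟨h1, h2.1, h2.2⟩
  obtain ⟨ε, hε, hb⟩ := Metric.eventually_nhds_iff_ball.1 hev
  refine ⟨ε, hε, fun w hw => ⟨(hb w hw).1, (hb w hw).2.1, fun t ht => ?_⟩⟩
  set B := Metric.ball (ξ x) ε with hB
  set g : unitInterval × B → G := fun p => ray ξ α (localInv hξ x p.2) (p.1 * t) with hg
  have hnn : ∀ p : unitInterval × B, (0 : ℝ) ≤ p.1 * t := fun p => mul_nonneg p.1.2.1 ht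
  have hgc : Continuous g := by
    refine hξ.continuous_lift (T2Space.isSeparatedMap ξ)
      ⟨fun p : unitInterval × B => (p.2 : ℂ) + ((p.1 * t : ℝ) : ℂ) * Complex.exp (α * Complex.I),
        by fun_prop⟩ ?_ ?_ ?_
    · funext p
      simp only [Function.comp_apply, ContinuousMap.coe_mk, hg]
      rw [(hΓ.isRay (hb p.2 p.2.2).1).2.2 _ (hnn p), (hb p.2 p.2.2).2.1]
    · have : (fun s : B => g (0, s)) = fun s : B => localInv hξ x s := by
        funext s
        simp only [hg, Set.Icc.coe_zero, zero_mul]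
        exact (hΓ.isRay (hb s s.2).1).2.1
      rw [this, continuous_iff_continuousAt]
      exact fun s => (hb s s.2).2.2.comp continuous_subtype_val.continuousAt
    · intro s
      exact (hΓ.isRay (hb s s.2).1).1.comp_continuous (by fun_prop) fun t => hnn (t, s)
  have h1 : ContinuousOn (fun v => ray ξ α (localInv hξ x v) t) B := by
    rw [continuousOn_iff_continuous_domRestrict]
    have h2 : Continuous fun v : B => g (1, v) := by fun_prop
    refine h2.congr fun v => ?_
    simp [hg]
  exact h1.continuousAt (Metric.isOpen_ball.mem_nhds hw)

theorem hasDerivAt_ray_localInv (hξ : IsLocalHomeomorph ξ) {α : ℝ} {Γ : Set G}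
    (hΓ : RayClosed ξ α Γ) {x : G} {f : G → ℂ} (hf : ∀ y ∈ Γ, AnalyticAtPt hξ f y)
    {ε : ℝ} (hε : ∀ w ∈ Metric.ball (ξ x) ε, localInv hξ x w ∈ Γ ∧ ξ (localInv hξ x w) = w ∧
      ∀ t : ℝ, 0 ≤ t → ContinuousAt (fun v => ray ξ α (localInv hξ x v) t) w)
    {w : ℂ} (hw : w ∈ Metric.ball (ξ x) ε) {t : ℝ} (ht : 0 ≤ t) :
    HasDerivAt (fun v => f (ray ξ α (localInv hξ x v) t))
      (dxi hξ 1 f (ray ξ α (localInv hξ x w) t)) w := by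
  have hpt : ∀ v ∈ Metric.ball (ξ x) ε, ξ (ray ξ α (localInv hξ x v) t) =
      v + t * Complex.exp (α * Complex.I) := fun v hv => by
    rw [(hΓ.isRay (hε v hv).1).2.2 t ht, (hε v hv).2.1]
  have h1 := eventually_eq_localInv hξ ((hε w hw).2.2 t ht)
  have h2 := hasDerivAt_germ hξ (hf _ (hΓ.ray_mem hξ (hε w hw).1 ht))
  rw [hpt w hw] at h2
  refine (h2.comp_add_const w _).congr_of_eventuallyEq ?_
  filter_upwards [h1, Metric.isOpen_ball.mem_nhds hw] with v hv hvb
  simp only [germ]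
  rw [hpt v hvb] at hv
  rw [← hv]

theorem hasDerivAt_ray (hξ : IsLocalHomeomorph ξ) {α : ℝ} {Γ : Set G}
    (hΓ : RayClosed ξ α Γ) {x : G} (hx : x ∈ Γ) {f : G → ℂ}
    (hf : ∀ y ∈ Γ, AnalyticAtPt hξ f y) {t : ℝ} (ht : 0 < t) :
    HasDerivAt (fun s => f (ray ξ α x s))
      (dxi hξ 1 f (ray ξ α x t) * Complex.exp (α * Complex.I)) t := by
  have hray := hΓ.isRay hx
  have h1 := eventually_eq_localInv hξ (hray.1.continuousAt (Ici_mem_nhds ht))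
  have h2 := hasDerivAt_germ hξ (hf _ (hΓ.ray_mem hξ hx ht.le))
  rw [hray.2.2 t ht.le] at h2
  have h3 : HasDerivAt (fun s : ℝ => ξ x + (s : ℂ) * Complex.exp (α * Complex.I))
      (Complex.exp (α * Complex.I)) t := by
    simpa using ((Complex.ofRealCLM.hasDerivAt (x := t)).mul_const
      (Complex.exp (α * Complex.I))).const_add (ξ x)
  refine (h2.comp t h3).congr_of_eventuallyEq ?_
  filter_upwards [h1, Ici_mem_nhds ht] with s hs hs0
  rw [hray.2.2 s hs0] at hs
  simp only [Function.comp_apply, germ]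
  rw [← hs]

theorem continuousOn_comp_ray (hξ : IsLocalHomeomorph ξ) {α : ℝ} {Γ : Set G}
    (hΓ : RayClosed ξ α Γ) {x : G} (hx : x ∈ Γ) {f : G → ℂ}
    (hf : ∀ y ∈ Γ, AnalyticAtPt hξ f y) :
    ContinuousOn (fun s => f (ray ξ α x s)) (Set.Ici 0) := by
  intro s hs
  exact (continuousAt_of_analyticAtPt hξ (hf _ (hΓ.ray_mem hξ hx hs))).comp_continuousWithinAt
    ((hΓ.isRay hx).1 s hs)

end Rays

end BorelGevrey

namespace BorelGevrey

open Filter Finset MeasureTheory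

/-! The weight `1 / (1 + |z|^{1+ρ})`. -/

/-- The weight `1 / (1 + |z|^{1+ρ})`. -/
noncomputable def wt (ρ : ℝ) (z : ℂ) : ℝ := 1 / (1 + ‖z‖ ^ (1 + ρ))

theorem wt_pos (ρ : ℝ) (z : ℂ) : 0 < wt ρ z := by
  unfold wt
  have := Real.rpow_nonneg (norm_nonneg z) (1 + ρ)
  positivity

theorem wt_le_one (ρ : ℝ) (z : ℂ) : wt ρ z ≤ 1 := by
  unfold wt
  have := Real.rpow_nonneg (norm_nonneg z) (1 + ρ)
  rw [div_le_one (by positivity)]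
  linarith

theorem rpow_add_le {p a b : ℝ} (hp : 0 ≤ p) (ha : 0 ≤ a) (hb : 0 ≤ b) :
    (a + b) ^ p ≤ 2 ^ p * (a ^ p + b ^ p) := by
  have h1 : (a + b) ^ p ≤ (2 * max a b) ^ p :=
    Real.rpow_le_rpow (by positivity) (by linarith [le_max_left a b, le_max_right a b]) hp
  rw [Real.mul_rpow (by norm_num) (by positivity)] at h1
  refine h1.trans (mul_le_mul_of_nonneg_left ?_ (by positivity))
  have ha' := Real.rpow_nonneg ha p
  have hb' := Real.rpow_nonneg hb p
  rcases le_total a b with h | h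
  · rw [max_eq_right h]; linarith
  · rw [max_eq_left h]; linarith

/-- The weights of two points at distance at most `d` are comparable. -/
theorem exists_wt_le {ρ : ℝ} (hρ : 0 < ρ) {d : ℝ} (hd : 0 < d) :
    ∃ K : ℝ, 0 < K ∧ ∀ z w : ℂ, ‖w - z‖ ≤ d → wt ρ w ≤ K * wt ρ z := by
  have h2 : (1 : ℝ) ≤ 2 ^ (1 + ρ) := Real.one_le_rpow (by norm_num) (by linarith)
  have hd' := Real.rpow_nonneg hd.le (1 + ρ)
  refine ⟨2 ^ (1 + ρ) * (1 + d ^ (1 + ρ)), by positivity, fun z w h => ?_⟩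
  unfold wt
  have hz := Real.rpow_nonneg (norm_nonneg z) (1 + ρ)
  have hw := Real.rpow_nonneg (norm_nonneg w) (1 + ρ)
  rw [mul_one_div, div_le_div_iff₀ (by positivity) (by positivity), one_mul]
  have h3 : ‖z‖ ≤ ‖w‖ + d := by
    have := norm_sub_norm_le z w
    rw [norm_sub_rev] at this
    linarith
  have h4 : ‖z‖ ^ (1 + ρ) ≤ 2 ^ (1 + ρ) * (‖w‖ ^ (1 + ρ) + d ^ (1 + ρ)) :=
    (Real.rpow_le_rpow (norm_nonneg _) h3 (by linarith)).trans
      (rpow_add_le (by linarith) (norm_nonneg _) hd.le)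
  have h5 : 0 ≤ 2 ^ (1 + ρ) * (d ^ (1 + ρ) * ‖w‖ ^ (1 + ρ)) := by positivity
  nlinarith

theorem integrable_one_div_one_add_rpow {ρ : ℝ} (hρ : 0 < ρ) :
    Integrable (fun s : ℝ => 1 / (1 + |s| ^ (1 + ρ))) := by
  have h1 : Integrable (fun s : ℝ => 2 ^ (1 + ρ) * (1 + ‖s‖) ^ (-(1 + ρ))) :=
    (integrable_one_add_norm (by simp; linarith)).const_mul _
  refine h1.mono' ?_ (ae_of_all _ fun s => ?_)
  · exact Measurable.aestronglyMeasurable (by fun_prop)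
  · have hs := Real.rpow_nonneg (abs_nonneg s) (1 + ρ)
    rw [Real.norm_of_nonneg (by positivity), Real.norm_eq_abs, Real.rpow_neg (by positivity),
      ← div_eq_mul_inv, div_le_div_iff₀ (by positivity) (by positivity), one_mul]
    have := rpow_add_le (p := 1 + ρ) (by linarith) zero_le_one (abs_nonneg s)
    rwa [Real.one_rpow] at this

theorem wt_le_of_ray {ρ : ℝ} (hρ : 0 < ρ) (z : ℂ) (α t : ℝ) :
    wt ρ (z + t * Complex.exp (α * Complex.I)) ≤
      1 / (1 + |(z * Complex.exp (-α * Complex.I)).re + t| ^ (1 + ρ)) := by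
  have h1 : ‖z + t * Complex.exp (α * Complex.I)‖ = ‖z * Complex.exp (-α * Complex.I) + t‖ := by
    have h2 : z * Complex.exp (-α * Complex.I) + t =
        (z + t * Complex.exp (α * Complex.I)) * Complex.exp ((-α : ℝ) * Complex.I) := by
      rw [add_mul, mul_assoc (t : ℂ), ← Complex.exp_add]
      simp
    rw [h2, norm_mul, Complex.norm_exp_ofReal_mul_I, mul_one]
  unfold wt
  rw [h1]
  have h3 := Complex.abs_re_le_norm (z * Complex.exp (-α * Complex.I) + t)
  rw [Complex.add_re, Complex.ofReal_re] at h3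
  have h4 := Real.rpow_nonneg (abs_nonneg ((z * Complex.exp (-α * Complex.I)).re + t)) (1 + ρ)
  gcongr

theorem continuous_wt_ray {ρ : ℝ} (hρ : 0 < ρ) (z : ℂ) (α : ℝ) :
    Continuous fun t : ℝ => wt ρ (z + t * Complex.exp (α * Complex.I)) := by
  unfold wt
  refine continuous_const.div ?_ fun t => ?_
  · refine continuous_const.add (Continuous.rpow_const (by fun_prop) fun t => Or.inr (by linarith))
  · have := Real.rpow_nonneg (norm_nonneg (z + t * Complex.exp (α * Complex.I))) (1 + ρ)
    positivity

theorem integrableOn_wt_ray {ρ : ℝ} (hρ : 0 < ρ) (z : ℂ) (α : ℝ) :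
    IntegrableOn (fun t : ℝ => wt ρ (z + t * Complex.exp (α * Complex.I))) (Set.Ioi 0) := by
  refine Integrable.integrableOn (((integrable_one_div_one_add_rpow hρ).comp_add_left
    (z * Complex.exp (-α * Complex.I)).re).mono'
      (continuous_wt_ray hρ z α).aestronglyMeasurable (ae_of_all _ fun t => ?_))
  rw [Real.norm_of_nonneg (wt_pos _ _).le]
  exact wt_le_of_ray hρ z α t

/-- The integral of the weight along a ray. -/
theorem exists_integral_wt_ray_le {ρ : ℝ} (hρ : 0 < ρ) :
    ∃ K : ℝ, 1 ≤ K ∧ ∀ (z : ℂ) (α : ℝ),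
      ∫ t in Set.Ioi (0 : ℝ), wt ρ (z + t * Complex.exp (α * Complex.I)) ≤
        K / max 1 (z * Complex.exp (-α * Complex.I)).re ^ ρ := by
  set φ : ℝ → ℝ := fun s => 1 / (1 + |s| ^ (1 + ρ)) with hφ
  have hφi : Integrable φ := integrable_one_div_one_add_rpow hρ
  have hφ0 : ∀ s, 0 ≤ φ s := fun s => by
    have := Real.rpow_nonneg (abs_nonneg s) (1 + ρ)
    simp only [hφ]; positivity
  refine ⟨max 1 (max (∫ s, φ s) (1 / ρ)), le_max_left _ _, fun z α => ?_⟩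
  set y := (z * Complex.exp (-α * Complex.I)).re
  have hstep : ∫ t in Set.Ioi (0 : ℝ), wt ρ (z + t * Complex.exp (α * Complex.I)) ≤
      ∫ t in Set.Ioi (0 : ℝ), φ (y + t) :=
    setIntegral_mono (integrableOn_wt_ray hρ z α) (hφi.comp_add_left y).integrableOn
      fun t => wt_le_of_ray hρ z α t
  refine hstep.trans ?_
  -- For y ≤ 1 the integral over the whole line suffices; for y > 1 the integrand is at most
  -- (y+t)^{-(1+ρ)}, whose integral is y^{-ρ}/ρ.
  rcases le_or_gt y 1 with hy | hy
  · rw [max_eq_left hy, Real.one_rpow, div_one]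
    refine le_trans ?_ ((le_max_left _ _).trans (le_max_right _ _))
    calc ∫ t in Set.Ioi (0 : ℝ), φ (y + t) ≤ ∫ t, φ (y + t) :=
          setIntegral_le_integral (hφi.comp_add_left y) (ae_of_all _ fun t => hφ0 _)
      _ = ∫ s, φ s := integral_add_left_eq_self φ y
  · rw [max_eq_right hy.le]
    have hy0 : 0 < y := by linarith
    have hd : ∀ t ∈ Set.Ici (0 : ℝ),
        HasDerivAt (fun t => -(y + t) ^ (-ρ) / ρ) ((y + t) ^ (-(1 + ρ))) t := by
      intro t ht
      have h0 : 0 < y + t := add_pos_of_pos_of_nonneg hy0 ht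
      have h1 := (((hasDerivAt_id t).const_add y).rpow_const (p := -ρ)
        (Or.inl h0.ne')).neg.div_const ρ
      refine h1.congr_deriv ?_
      simp only [id, show -ρ - 1 = -(1 + ρ) by ring]
      field_simp
    have hlim : Tendsto (fun t => -(y + t) ^ (-ρ) / ρ) atTop (𝓝 0) := by
      have := ((tendsto_rpow_neg_atTop hρ).comp
        (tendsto_atTop_add_const_left atTop y tendsto_id)).neg.div_const ρ
      simpa [Function.comp_def] using this
    have hnn : ∀ t ∈ Set.Ioi (0 : ℝ), 0 ≤ (y + t) ^ (-(1 + ρ)) := fun t ht =>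
      Real.rpow_nonneg (by linarith [Set.mem_Ioi.1 ht]) _
    have hI := integrableOn_Ioi_deriv_of_nonneg' hd hnn hlim
    have hint := integral_Ioi_of_hasDerivAt_of_tendsto' hd hI hlim
    calc ∫ t in Set.Ioi (0 : ℝ), φ (y + t) ≤ ∫ t in Set.Ioi (0 : ℝ), (y + t) ^ (-(1 + ρ)) := by
          refine setIntegral_mono_on (hφi.comp_add_left y).integrableOn hI measurableSet_Ioi ?_
          intro t ht
          have h0 : 0 < y + t := by linarith [Set.mem_Ioi.1 ht]
          have h1 := Real.rpow_pos_of_pos h0 (1 + ρ)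
          simp only [hφ]
          rw [abs_of_pos h0, Real.rpow_neg h0.le, ← one_div]
          gcongr
          linarith
      _ = (1 / ρ) / y ^ ρ := by
          rw [hint, add_zero, Real.rpow_neg hy0.le]
          field_simp
          ring
      _ ≤ _ := by
          gcongr
          exact (le_max_right _ _).trans (le_max_right _ _)

theorem tendsto_wt_ray {ρ : ℝ} (hρ : 0 < ρ) (z : ℂ) (α : ℝ) :
    Tendsto (fun t : ℝ => wt ρ (z + t * Complex.exp (α * Complex.I))) atTop (𝓝 0) := by
  set y := (z * Complex.exp (-α * Complex.I)).re
  have h1 : Tendsto (fun t : ℝ => 1 / (1 + |y + t| ^ (1 + ρ))) atTop (𝓝 0) := by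
    have h2 : Tendsto (fun t : ℝ => |y + t|) atTop atTop :=
      tendsto_abs_atTop_atTop.comp (tendsto_atTop_add_const_left atTop y tendsto_id)
    have h3 := (tendsto_rpow_atTop (show 0 < 1 + ρ by linarith)).comp h2
    simp only [one_div]
    exact (tendsto_atTop_add_const_left atTop 1 h3).inv_tendsto_atTop
  exact squeeze_zero (fun t => (wt_pos _ _).le) (fun t => wt_le_of_ray hρ z α t) h1

/-! Integrals along rays. -/

section RayIntegral

variable {G : Type*} [TopologicalSpace G] {ξ : G → ℂ} (hξ : IsLocalHomeomorph ξ)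

/-- `f` is analytic in `Γ`, and `f`, `f'` are there bounded by multiples of the weight. -/
structure DecayOn (ρ : ℝ) (Γ : Set G) (f : G → ℂ) : Prop where
  analytic : ∀ x ∈ Γ, AnalyticAtPt hξ f x
  bound : ∃ C : ℝ, ∀ x ∈ Γ, ‖f x‖ ≤ C * wt ρ (ξ x)
  bound_deriv : ∃ C : ℝ, ∀ x ∈ Γ, ‖dxi hξ 1 f x‖ ≤ C * wt ρ (ξ x)

variable {hξ} {α ρ : ℝ} {Γ : Set G} {f : G → ℂ}

theorem AnalyticAtPt.dxi {x : G} (hf : AnalyticAtPt hξ f x) (r : ℕ) :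
    AnalyticAtPt hξ (dxi hξ r f) x := by
  have h1 : AnalyticAt ℂ (iteratedDeriv r (germ hξ f x)) (ξ x) := by
    rw [iteratedDeriv_eq_iterate]
    exact AnalyticAt.iterated_deriv hf r
  exact h1.congr (germ_dxi hξ r f x).symm

/-- Complex differentiability at every point of an open set already gives analyticity. The
hypothesis concerns a different chart at each point, and `germ_localInv` transports it to one chart.
-/
theorem analyticAtPt_of_hasDerivAt (hΓo : IsOpen Γ) {g : G → ℂ}
    (h : ∀ x ∈ Γ, HasDerivAt (germ hξ f x) (g x) (ξ x)) {x : G} (hx : x ∈ Γ) :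
    AnalyticAtPt hξ f x ∧ BorelGevrey.dxi hξ 1 f x = g x := by
  constructor
  · refine Complex.analyticAt_iff_eventually_differentiableAt.2 ?_
    filter_upwards [tendsto_localInv hξ x (hΓo.mem_nhds hx), eventually_localInv hξ x,
      germ_localInv hξ f x] with w h1 h2 h3
    have h4 := h _ h1
    rw [h2.1] at h4
    exact (h4.congr_of_eventuallyEq h3.symm).differentiableAt
  · rw [BorelGevrey.dxi, iteratedDeriv_one]
    exact (h x hx).deriv

variable [T2Space G]

theorem norm_comp_ray_le (hΓ : RayClosed ξ α Γ) {x : G} (hx : x ∈ Γ) {C : ℝ}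
    (hC : ∀ x ∈ Γ, ‖f x‖ ≤ C * wt ρ (ξ x)) {t : ℝ} (ht : 0 ≤ t) (hξ : IsLocalHomeomorph ξ) :
    ‖f (ray ξ α x t)‖ ≤ C * wt ρ (ξ x + t * Complex.exp (α * Complex.I)) := by
  rw [← (hΓ.isRay hx).2.2 t ht]
  exact hC _ (hΓ.ray_mem hξ hx ht)

theorem aestronglyMeasurable_comp_ray (hΓ : RayClosed ξ α Γ) {x : G} (hx : x ∈ Γ)
    (hf : ∀ y ∈ Γ, AnalyticAtPt hξ f y) :
    AEStronglyMeasurable (fun t => f (ray ξ α x t)) (volume.restrict (Set.Ioi 0)) :=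
  ((continuousOn_comp_ray hξ hΓ hx hf).mono Set.Ioi_subset_Ici_self).aestronglyMeasurable
    measurableSet_Ioi

theorem DecayOn.rayIntegrable (hρ : 0 < ρ) (hΓ : RayClosed ξ α Γ) (hf : DecayOn hξ ρ Γ f) {x : G}
    (hx : x ∈ Γ) : RayIntegrable ξ α f x := by
  obtain ⟨C, hC⟩ := hf.bound
  refine ((integrableOn_wt_ray hρ (ξ x) α).const_mul C).mono'
    (aestronglyMeasurable_comp_ray hΓ hx hf.analytic)
    ((ae_restrict_iff' measurableSet_Ioi).2 (ae_of_all _ fun t ht => ?_))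
  exact norm_comp_ray_le hΓ hx hC (le_of_lt ht) hξ

theorem norm_rayIntegral_le (hρ : 0 < ρ) (hΓ : RayClosed ξ α Γ) (hξ : IsLocalHomeomorph ξ) {x : G}
    (hx : x ∈ Γ) {C : ℝ} (hC : ∀ x ∈ Γ, ‖f x‖ ≤ C * wt ρ (ξ x)) :
    ‖rayIntegral ξ α f x‖ ≤
      C * ∫ t in Set.Ioi (0 : ℝ), wt ρ (ξ x + t * Complex.exp (α * Complex.I)) := by
  rw [rayIntegral, norm_mul, Complex.norm_exp_ofReal_mul_I, one_mul, ← integral_const_mul]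
  refine norm_integral_le_of_norm_le ((integrableOn_wt_ray hρ (ξ x) α).const_mul C)
    ((ae_restrict_iff' measurableSet_Ioi).2 (ae_of_all _ fun t ht => ?_))
  exact norm_comp_ray_le hΓ hx hC (le_of_lt ht) hξ

/-- Differentiate under the integral sign. The derivative in the starting point, multiplied by
e^{iα}, is the derivative along the ray, so the new integral telescopes to 0 - f(x). -/
theorem DecayOn.hasDerivAt (hρ : 0 < ρ) (hΓo : IsOpen Γ) (hΓ : RayClosed ξ α Γ)
    (hf : DecayOn hξ ρ Γ f) {x : G} (hx : x ∈ Γ) :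
    HasDerivAt (germ hξ (rayIntegral ξ α f) x) (-f x) (ξ x) := by
  obtain ⟨C, hC⟩ := hf.bound
  obtain ⟨C', hC'⟩ := hf.bound_deriv
  obtain ⟨ε, hε, hb⟩ := continuousAt_ray_localInv hξ hΓo hΓ hx
  obtain ⟨K, hK, hKw⟩ := exists_wt_le hρ hε
  set e := Complex.exp (α * Complex.I) with he
  have hC'0 : 0 ≤ C' := by
    have := (norm_nonneg _).trans (hC' x hx)
    exact nonneg_of_mul_nonneg_left this (wt_pos _ _)
  have hanal' : ∀ y ∈ Γ, AnalyticAtPt hξ (BorelGevrey.dxi hξ 1 f) y := fun y hy =>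
    (hf.analytic y hy).dxi 1
  have key := hasDerivAt_integral_of_dominated_loc_of_deriv_le (𝕜 := ℂ)
    (μ := volume.restrict (Set.Ioi (0 : ℝ))) (F := fun w t => f (ray ξ α (localInv hξ x w) t))
    (F' := fun w t => BorelGevrey.dxi hξ 1 f (ray ξ α (localInv hξ x w) t))
    (bound := fun t => C' * (K * wt ρ (ξ x + t * e)))
    (x₀ := ξ x) (s := Metric.ball (ξ x) ε) (Metric.ball_mem_nhds _ hε) ?_ ?_ ?_ ?_ ?_ ?_
  · have hx' := localInv_self hξ x
    have hd : ∫ t in Set.Ioi (0 : ℝ), BorelGevrey.dxi hξ 1 f (ray ξ α x t) * e = 0 - f x := by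
      have h0 : ray ξ α x 0 = x := (hΓ.isRay hx).2.1
      have := integral_Ioi_of_hasDerivAt_of_tendsto (m := 0)
        ((continuousOn_comp_ray hξ hΓ hx hf.analytic) 0 Set.self_mem_Ici)
        (fun t ht => hasDerivAt_ray hξ hΓ hx hf.analytic ht) ?_ ?_
      · rwa [h0] at this
      · have h1 := key.1
        simp only [hx'] at h1
        exact h1.mul_const e
      · have h2 := (tendsto_wt_ray hρ (ξ x) α).const_mul C
        rw [mul_zero] at h2
        refine squeeze_zero_norm' ?_ h2
        filter_upwards [eventually_ge_atTop 0] with t ht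
        exact norm_comp_ray_le hΓ hx hC ht hξ
    have h3 := key.2.const_mul e
    refine h3.congr_deriv ?_
    rw [hx', mul_comm, ← integral_mul_const, hd, zero_sub]
  · filter_upwards [Metric.ball_mem_nhds _ hε] with w hw
    exact aestronglyMeasurable_comp_ray hΓ (hb w hw).1 hf.analytic
  · rw [localInv_self]
    exact hf.rayIntegrable hρ hΓ hx
  · rw [localInv_self]
    exact aestronglyMeasurable_comp_ray hΓ hx hanal'
  · refine (ae_restrict_iff' measurableSet_Ioi).2 (ae_of_all _ fun t ht w hw => ?_)
    have h1 := norm_comp_ray_le hΓ (hb w hw).1 hC' (le_of_lt ht) hξ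
    refine h1.trans (mul_le_mul_of_nonneg_left ?_ hC'0)
    rw [(hb w hw).2.1]
    refine hKw _ _ ?_
    rw [add_sub_add_right_eq_sub]
    exact (mem_ball_iff_norm.1 hw).le
  · exact ((integrableOn_wt_ray hρ (ξ x) α).const_mul K).const_mul C'
  · refine (ae_restrict_iff' measurableSet_Ioi).2 (ae_of_all _ fun t ht w hw => ?_)
    exact hasDerivAt_ray_localInv hξ hΓ hf.analytic hb hw (le_of_lt ht)

end RayIntegral

end BorelGevrey

namespace BorelGevrey

open Filter Finset MeasureTheory Asymptotics

/-! Watson's lemma and the uniqueness of asymptotic expansions. -/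

theorem integral_pow_mul_exp_neg {u : ℝ} (hu : 0 < u) (m : ℕ) :
    IntegrableOn (fun t : ℝ => t ^ m * Real.exp (-(u * t))) (Set.Ioi 0) ∧
      ∫ t in Set.Ioi (0 : ℝ), t ^ m * Real.exp (-(u * t)) = m.factorial / u ^ (m + 1) := by
  have h1 := Real.integral_rpow_mul_exp_neg_mul_Ioi (a := m + 1) (r := u) (by positivity) hu
  rw [Real.Gamma_nat_eq_factorial] at h1
  have h2 : ∫ t in Set.Ioi (0 : ℝ), t ^ m * Real.exp (-(u * t)) = m.factorial / u ^ (m + 1) := by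
    rw [show (m.factorial : ℝ) / u ^ (m + 1) = (1 / u) ^ ((m : ℝ) + 1) * m.factorial by
      rw [show (m : ℝ) + 1 = ((m + 1 : ℕ) : ℝ) by push_cast; ring, Real.rpow_natCast, div_pow,
        one_pow]
      field_simp, ← h1]
    refine setIntegral_congr_fun measurableSet_Ioi fun t _ => ?_
    simp [Real.rpow_natCast]
  refine ⟨?_, h2⟩
  -- A non-integrable function has Bochner integral 0 by convention, whereas the value just found is
  -- positive.
  by_contra h
  have h3 := integral_undef h
  rw [h2] at h3
  have : (0 : ℝ) < m.factorial / u ^ (m + 1) := by positivity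
  linarith

theorem ofReal_mem_tube {r t : ℝ} (hr : 0 < r) (ht : 0 ≤ t) : (t : ℂ) ∈ tube r := by
  rcases ht.eq_or_lt with rfl | h
  · exact Or.inr (by simpa using hr)
  · exact Or.inl (by simpa using ⟨h, hr⟩)

/-- The Taylor remainder of a function of exponential growth on the half-line. -/
theorem exists_norm_taylor_remainder_le {g : ℂ → ℂ} {M σ : ℝ} (hM : 0 ≤ M) (hσ : 0 ≤ σ)
    (hg : AnalyticAt ℂ g 0) (hb : ∀ t : ℝ, 0 ≤ t → ‖g t‖ ≤ M * Real.exp (σ * t)) (N : ℕ) :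
    ∃ K : ℝ, 0 ≤ K ∧ ∀ t : ℝ, 0 < t →
      ‖g t - ∑ m ∈ range N, iteratedDeriv m g 0 / m.factorial * (t : ℂ) ^ m‖ ≤
        K * (t ^ N * Real.exp (σ * t)) := by
  set c : ℕ → ℂ := fun m => iteratedDeriv m g 0 / m.factorial with hc
  have h1 := hg.hasFPowerSeriesAt.isBigO_sub_partialSum_pow N
  obtain ⟨C, hC, h2⟩ := h1.exists_pos
  obtain ⟨δ, hδ, h3⟩ := Metric.eventually_nhds_iff_ball.1 h2.bound
  refine ⟨C + (M / δ ^ N + ∑ m ∈ range N, ‖c m‖ / δ ^ (N - m)), by positivity, fun t ht => ?_⟩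
  have hexp : 1 ≤ Real.exp (σ * t) := Real.one_le_exp (by positivity)
  have hS : 0 ≤ M / δ ^ N + ∑ m ∈ range N, ‖c m‖ / δ ^ (N - m) := by positivity
  rcases lt_or_ge t δ with htδ | htδ
  · have h4 := h3 (t : ℂ) (by simpa [abs_of_pos ht] using htδ)
    rw [zero_add, norm_pow, Complex.norm_real, norm_norm, Real.norm_of_nonneg ht.le] at h4
    have h5 : FormalMultilinearSeries.partialSum (FormalMultilinearSeries.ofScalars ℂ
        fun n => iteratedDeriv n g 0 / n.factorial) N (t : ℂ) =
        ∑ m ∈ range N, c m * (t : ℂ) ^ m := by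
      simp only [FormalMultilinearSeries.partialSum, FormalMultilinearSeries.ofScalars_apply_eq,
        smul_eq_mul, hc]
    rw [h5] at h4
    refine h4.trans ?_
    rw [add_mul]
    have h6 : C * t ^ N ≤ C * (t ^ N * Real.exp (σ * t)) := by
      gcongr
      exact le_mul_of_one_le_right (by positivity) hexp
    have h7 : 0 ≤ (M / δ ^ N + ∑ m ∈ range N, ‖c m‖ / δ ^ (N - m)) *
        (t ^ N * Real.exp (σ * t)) := by positivity
    linarith
  -- Away from 0 no cancellation is needed: since t/δ ≥ 1, both `g` and each monomial of the Taylor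
  -- polynomial are bounded by a multiple of t^N e^{σt}.
  · have hdiv : 1 ≤ t / δ := (one_le_div hδ).2 htδ
    have h4 : ‖g t‖ ≤ M / δ ^ N * (t ^ N * Real.exp (σ * t)) := by
      refine (hb t ht.le).trans ?_
      have h5 : 1 ≤ (t / δ) ^ N := one_le_pow₀ hdiv
      calc M * Real.exp (σ * t) ≤ M * Real.exp (σ * t) * (t / δ) ^ N :=
            le_mul_of_one_le_right (by positivity) h5
        _ = _ := by rw [div_pow]; ring
    have h5 : ‖∑ m ∈ range N, c m * (t : ℂ) ^ m‖ ≤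
        (∑ m ∈ range N, ‖c m‖ / δ ^ (N - m)) * (t ^ N * Real.exp (σ * t)) := by
      rw [sum_mul]
      refine norm_sum_le_of_le _ fun m hm => ?_
      have hmN : m ≤ N := (mem_range.1 hm).le
      rw [norm_mul, norm_pow, Complex.norm_real, Real.norm_of_nonneg ht.le]
      have h6 : 1 ≤ (t / δ) ^ (N - m) := one_le_pow₀ hdiv
      calc ‖c m‖ * t ^ m ≤ ‖c m‖ * t ^ m * ((t / δ) ^ (N - m) * Real.exp (σ * t)) :=
            le_mul_of_one_le_right (by positivity) (one_le_mul_of_one_le_of_one_le h6 hexp)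
        _ = ‖c m‖ / δ ^ (N - m) * ((t ^ m * t ^ (N - m)) * Real.exp (σ * t)) := by
            rw [div_pow]; ring
        _ = _ := by rw [← pow_add, Nat.add_sub_cancel' hmN]
    refine (norm_sub_le _ _).trans ?_
    have h7 : 0 ≤ C * (t ^ N * Real.exp (σ * t)) := by positivity
    linarith

/-- Watson's lemma. -/
theorem isLittleO_laplace_sub {g : ℂ → ℂ} {M σ : ℝ} (hM : 0 ≤ M) (hσ : 0 ≤ σ)
    (hg : AnalyticAt ℂ g 0) (hgc : ContinuousOn (fun t : ℝ => g t) (Set.Ioi 0))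
    (hb : ∀ t : ℝ, 0 ≤ t → ‖g t‖ ≤ M * Real.exp (σ * t)) (N : ℕ) :
    (fun u : ℝ => (∫ t in Set.Ioi (0 : ℝ), Complex.exp (-(u : ℂ) * t) * g t) -
      ∑ m ∈ Icc 1 N, iteratedDeriv (m - 1) g 0 / (u : ℂ) ^ m) =o[atTop] fun u => (u ^ N)⁻¹ := by
  obtain ⟨K, hK, hR⟩ := exists_norm_taylor_remainder_le hM hσ hg hb N
  set c : ℕ → ℂ := fun m => iteratedDeriv m g 0 / m.factorial with hc
  have hbig : (fun u : ℝ => (∫ t in Set.Ioi (0 : ℝ), Complex.exp (-(u : ℂ) * t) * g t) -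
      ∑ m ∈ Icc 1 N, iteratedDeriv (m - 1) g 0 / (u : ℂ) ^ m) =O[atTop]
        fun u => (u ^ (N + 1))⁻¹ := by
    -- The remainder contributes at most K N!/(u-σ)^{N+1}, and u - σ ≥ u/2 as soon as u ≥ 2σ.
    refine IsBigO.of_bound (K * (N.factorial * 2 ^ (N + 1))) ?_
    filter_upwards [eventually_ge_atTop (2 * σ), eventually_gt_atTop 0] with u hu hu0
    have hu2 : u / 2 ≤ u - σ := by linarith
    have hus : 0 < u - σ := by linarith
    have hterm : ∀ m : ℕ, ∀ t : ℝ, c m * ((t ^ m * Real.exp (-(u * t)) : ℝ) : ℂ) =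
        Complex.exp (-(u : ℂ) * t) * (c m * (t : ℂ) ^ m) := by
      intro m t
      push_cast
      rw [neg_mul]
      ring
    have hint : ∀ m : ℕ, IntegrableOn
        (fun t : ℝ => Complex.exp (-(u : ℂ) * t) * (c m * (t : ℂ) ^ m)) (Set.Ioi 0) := by
      intro m
      have := ((integral_pow_mul_exp_neg hu0 m).1.ofReal (𝕜 := ℂ)).const_mul (c m)
      refine this.congr (ae_of_all _ fun t => ?_)
      exact hterm m t
    have hval : ∀ m : ℕ, ∫ t in Set.Ioi (0 : ℝ), Complex.exp (-(u : ℂ) * t) *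
        (c m * (t : ℂ) ^ m) = iteratedDeriv m g 0 / (u : ℂ) ^ (m + 1) := by
      intro m
      simp only [← hterm]
      have hre : ∫ t in Set.Ioi (0 : ℝ), ((t ^ m * Real.exp (-(u * t)) : ℝ) : ℂ) =
          ((∫ t in Set.Ioi (0 : ℝ), t ^ m * Real.exp (-(u * t)) : ℝ) : ℂ) := integral_ofReal
      rw [integral_const_mul, hre, (integral_pow_mul_exp_neg hu0 m).2, hc]
      have : (m.factorial : ℂ) ≠ 0 := by exact_mod_cast m.factorial_ne_zero
      push_cast
      field_simp
    set R : ℝ → ℂ := fun t => g t - ∑ m ∈ range N, c m * (t : ℂ) ^ m with hRdef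
    have hRb : ∀ t ∈ Set.Ioi (0 : ℝ), ‖Complex.exp (-(u : ℂ) * t) * R t‖ ≤
        K * (t ^ N * Real.exp (-((u - σ) * t))) := by
      intro t ht
      rw [norm_mul, Complex.norm_exp]
      have h1 : (-(u : ℂ) * t).re = -(u * t) := by simp
      rw [h1]
      calc Real.exp (-(u * t)) * ‖R t‖
          ≤ Real.exp (-(u * t)) * (K * (t ^ N * Real.exp (σ * t))) := by
            gcongr
            exact hR t ht
        _ = K * (t ^ N * (Real.exp (-(u * t)) * Real.exp (σ * t))) := by ring
        _ = _ := by rw [← Real.exp_add]; ring_nf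
    have hmaj := (integral_pow_mul_exp_neg hus N).1.const_mul K
    have hRi : IntegrableOn (fun t : ℝ => Complex.exp (-(u : ℂ) * t) * R t) (Set.Ioi 0) := by
      refine hmaj.mono' ?_ ((ae_restrict_iff' measurableSet_Ioi).2 (ae_of_all _ hRb))
      refine ContinuousOn.aestronglyMeasurable ?_ measurableSet_Ioi
      refine ContinuousOn.mul (by fun_prop) (hgc.sub (by fun_prop))
    have hsplit : ∫ t in Set.Ioi (0 : ℝ), Complex.exp (-(u : ℂ) * t) * g t =
        (∫ t in Set.Ioi (0 : ℝ), Complex.exp (-(u : ℂ) * t) * R t) +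
          ∑ m ∈ range N, iteratedDeriv m g 0 / (u : ℂ) ^ (m + 1) := by
      simp only [← hval]
      rw [← integral_finsetSum _ fun m _ => hint m,
        ← integral_add hRi (integrable_finsetSum _ fun m _ => hint m)]
      refine setIntegral_congr_fun measurableSet_Ioi fun t _ => ?_
      simp only [hRdef, ← mul_sum]
      ring
    have hsum : ∑ m ∈ Icc 1 N, iteratedDeriv (m - 1) g 0 / (u : ℂ) ^ m =
        ∑ m ∈ range N, iteratedDeriv m g 0 / (u : ℂ) ^ (m + 1) := by
      rw [range_eq_Ico]
      exact (sum_Ico_add' (fun m => iteratedDeriv (m - 1) g 0 / (u : ℂ) ^ m) 0 N 1).symm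
    rw [hsplit, hsum, add_sub_cancel_right]
    refine (norm_integral_le_of_norm_le hmaj
      ((ae_restrict_iff' measurableSet_Ioi).2 (ae_of_all _ hRb))).trans ?_
    rw [integral_const_mul, (integral_pow_mul_exp_neg hus N).2, mul_assoc,
      Real.norm_of_nonneg (by positivity)]
    refine mul_le_mul_of_nonneg_left ?_ hK
    calc (N.factorial : ℝ) / (u - σ) ^ (N + 1) ≤ N.factorial / (u / 2) ^ (N + 1) := by gcongr
      _ = _ := by rw [div_pow]; field_simp
  refine hbig.trans_isLittleO ?_
  refine IsLittleO.inv_rev (isLittleO_pow_pow_atTop_of_lt (Nat.lt_succ_self N)) ?_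
  filter_upwards [eventually_gt_atTop 0] with u hu h
  exact absurd h (by positivity)

/-- Uniqueness of asymptotic expansions. -/
theorem eq_of_isLittleO_expansion {F : ℝ → ℂ} {a b : ℕ → ℂ}
    (ha : ∀ N : ℕ, (fun u : ℝ => F u - ∑ m ∈ Icc 1 N, a m / (u : ℂ) ^ m)
      =o[atTop] fun u => (u ^ N)⁻¹)
    (hb : ∀ N : ℕ, (fun u : ℝ => F u - ∑ m ∈ Icc 1 N, b m / (u : ℂ) ^ m)
      =o[atTop] fun u => (u ^ N)⁻¹) {m : ℕ} (hm : 1 ≤ m) : a m = b m := by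
  induction m using Nat.strong_induction_on with
  | _ m ih =>
  -- The lower coefficients agree by induction, so subtracting the two expansions truncated at order
  -- m leaves only the m-th term.
  have h1 : (fun u : ℝ => (b m - a m) / (u : ℂ) ^ m) =o[atTop] fun u : ℝ => (u ^ m)⁻¹ := by
    refine ((ha m).sub (hb m)).congr_left fun u => ?_
    obtain ⟨k, rfl⟩ : ∃ k, m = k + 1 := ⟨m - 1, by omega⟩
    rw [sum_Icc_succ_top (by omega), sum_Icc_succ_top (by omega),
      sum_congr rfl fun i hi => by
        rw [ih i (by rw [mem_Icc] at hi; omega) (mem_Icc.1 hi).1]]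
    ring
  by_contra hne
  have hpos : 0 < ‖b m - a m‖ := norm_pos_iff.2 (sub_ne_zero.2 (Ne.symm hne))
  obtain ⟨u, hu, hu0⟩ := ((isLittleO_iff.1 h1 (half_pos hpos)).and (eventually_gt_atTop 0)).exists
  rw [norm_div, norm_pow, Complex.norm_real, Real.norm_of_nonneg hu0.le,
    Real.norm_of_nonneg (by positivity), div_eq_mul_inv] at hu
  have h2 : 0 < (u ^ m)⁻¹ := by positivity
  have := le_of_mul_le_mul_right hu h2
  linarith

/-- The t-derivative is the Fréchet derivative applied to (1, 0), which preserves joint analyticity.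
It serves to show that ψ_{k,m} is analytic in ξ. -/
theorem analyticAt_iteratedDeriv_param {F : ℂ × ℂ → ℂ} {t z : ℂ} (hF : AnalyticAt ℂ F (t, z))
    (m : ℕ) : AnalyticAt ℂ (fun p : ℂ × ℂ => iteratedDeriv m (fun s => F (s, p.2)) p.1) (t, z) := by
  induction m with
  | zero => simpa using hF
  | succ m ih =>
    have h1 : AnalyticAt ℂ (fun p : ℂ × ℂ => fderiv ℂ
        (fun q : ℂ × ℂ => iteratedDeriv m (fun s => F (s, q.2)) q.1) p (1, 0)) (t, z) :=
      ((ContinuousLinearMap.apply ℂ ℂ ((1, 0) : ℂ × ℂ)).analyticAt _).comp ih.fderiv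
    refine h1.congr ?_
    filter_upwards [ih.eventually_analyticAt] with p hp
    rw [iteratedDeriv_succ]
    have h2 : HasDerivAt (fun s : ℂ => (s, p.2)) ((1, 0) : ℂ × ℂ) p.1 :=
      (hasDerivAt_id p.1).prodMk (hasDerivAt_const p.1 p.2)
    have h3 := HasFDerivAt.comp_hasDerivAt (f := fun s : ℂ => (s, p.2)) p.1
      (l := fun q : ℂ × ℂ => iteratedDeriv m (fun s => F (s, q.2)) q.1)
      (by exact hp.differentiableAt.hasFDerivAt) h2
    exact h3.deriv.symm

/-! The coefficients of the potentials. -/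

section Potentials

variable {G : Type*} [TopologicalSpace G] {ξ : G → ℂ} {hξ : IsLocalHomeomorph ξ}
  {n : ℕ} {Δ : Set G} {ψ Ψ : ℕ → ℂ → G → ℂ} {ψc : ℕ → ℕ → G → ℂ} {d d' c ρ σ' : ℝ}

theorem BorelCondition.analyticAt (h : BorelCondition n hξ Δ ψ Ψ d' c ρ σ') {k : ℕ}
    (hk : k < n - 1) {t : ℂ} (ht : t ∈ tube (aConst n * d')) {x : G} (hx : x ∈ Δ) :
    AnalyticAt ℂ (fun s => Ψ k s x) t := by
  have h1 : AnalyticAt ℂ (fun s : ℂ => (s, ξ x)) t := by fun_prop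
  have h2 := AnalyticAt.comp (f := fun s : ℂ => (s, ξ x)) (h.analytic k hk t ht x hx) h1
  simpa only [Function.comp_def, localInv_self] using h2

/-- Watson's lemma expands the Laplace integral with these derivatives as coefficients, and an
asymptotic expansion determines its coefficients. -/
theorem BorelCondition.coeff_eq (hr : 0 < aConst n * d')
    (h : BorelCondition n hξ Δ ψ Ψ d' c ρ σ') (hψ : HasExpansion n Δ ψ ψc) {k : ℕ}
    (hk : k < n - 1) {x : G} (hx : x ∈ Δ) {m : ℕ} (hm : 1 ≤ m) :
    ψc k m x = iteratedDeriv (m - 1) (fun t => Ψ k t x) 0 := by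
  refine eq_of_isLittleO_expansion (F := fun u => ψ k u x - if k = 0 then 1 else 0)
    (a := fun m => ψc k m x) (b := fun m => iteratedDeriv (m - 1) (fun t => Ψ k t x) 0)
    (fun N => ?_) (fun N => ?_) hm
  · refine (hψ k hk x hx N).congr_left fun u => ?_
    ring
  · have h0 : (0 : ℂ) ∈ tube (aConst n * d') := by simpa using ofReal_mem_tube hr le_rfl
    have hc := h.c_pos
    have hw := (wt_pos ρ (ξ x)).le
    have := isLittleO_laplace_sub (g := fun t => Ψ k t x) (M := c * wt ρ (ξ x)) (σ := σ')
      (by positivity) h.sigma_nonneg (h.analyticAt hk h0 hx) ?_ ?_ N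
    · refine this.congr' ?_ EventuallyEq.rfl
      filter_upwards [eventually_gt_atTop σ'] with u hu
      rw [h.laplace k hk u (by simpa using hu) x hx, add_sub_cancel_left]
    · intro t ht
      exact ((h.analyticAt hk (ofReal_mem_tube hr (le_of_lt ht)) hx).continuousAt.comp
        Complex.continuous_ofReal.continuousAt).continuousWithinAt
    · intro t ht
      have := h.growth k hk t (ofReal_mem_tube hr ht) x hx
      rw [Complex.ofReal_re] at this
      refine this.trans (le_of_eq ?_)
      unfold wt
      ring

theorem BorelCondition.coeff_analytic (hΔ : IsOpen Δ) (hr : 0 < aConst n * d')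
    (h : BorelCondition n hξ Δ ψ Ψ d' c ρ σ') (hψ : HasExpansion n Δ ψ ψc) {k : ℕ}
    (hk : k < n - 1) {x : G} (hx : x ∈ Δ) {m : ℕ} (hm : 1 ≤ m) :
    AnalyticAtPt hξ (ψc k m) x := by
  have h0 : (0 : ℂ) ∈ tube (aConst n * d') := by simpa using ofReal_mem_tube hr le_rfl
  have h1 : AnalyticAt ℂ (fun w : ℂ => ((0 : ℂ), w)) (ξ x) := by fun_prop
  have h2 := AnalyticAt.comp (f := fun w : ℂ => ((0 : ℂ), w))
    (analyticAt_iteratedDeriv_param (h.analytic k hk 0 h0 x hx) (m - 1)) h1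
  refine h2.congr ?_
  filter_upwards [tendsto_localInv hξ x (hΔ.mem_nhds hx)] with w hw
  exact (h.coeff_eq hr hψ hk hw hm).symm

/-- Cauchy's estimate in the variable t on the circle of radius R, which lies in the tube because R
< a·d'. -/
theorem BorelCondition.coeff_norm_le {R : ℝ} (hR : 0 < R) (hRr : R < aConst n * d')
    (h : BorelCondition n hξ Δ ψ Ψ d' c ρ σ') (hψ : HasExpansion n Δ ψ ψc) {k : ℕ}
    (hk : k < n - 1) {x : G} (hx : x ∈ Δ) {m : ℕ} (hm : 1 ≤ m) :
    ‖ψc k m x‖ ≤ c * Real.exp (σ' * R) * ((m - 1).factorial / R ^ (m - 1)) * wt ρ (ξ x) := by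
  have hball : Metric.closedBall (0 : ℂ) R ⊆ tube (aConst n * d') := fun t ht =>
    Or.inr (Metric.closedBall_subset_ball hRr ht)
  rw [h.coeff_eq (hR.trans hRr) hψ hk hx hm]
  have hdiff : DifferentiableOn ℂ (fun t => Ψ k t x) (tube (aConst n * d')) := fun t ht =>
    (h.analyticAt hk ht hx).differentiableAt.differentiableWithinAt
  have hc := h.c_pos
  have h1 := Complex.norm_iteratedDeriv_le_of_forall_mem_sphere_norm_le (m - 1) hR
    (hdiff.diffContOnCl_ball hball) (C := c * (Real.exp (σ' * R) * wt ρ (ξ x))) ?_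
  · refine h1.trans (le_of_eq ?_)
    ring
  · intro t ht
    have h2 := h.growth k hk t (hball (Metric.sphere_subset_closedBall ht)) x hx
    refine h2.trans ?_
    rw [div_eq_mul_one_div]
    have h3 : t.re ≤ R := (Complex.re_le_norm t).trans (by simpa using ht.le)
    have h4 := h.sigma_nonneg
    have h5 := (wt_pos ρ (ξ x)).le
    unfold wt at h5 ⊢
    gcongr

theorem BoundaryDistGE.mem (hd : 0 < d) {x : G} (hx : BoundaryDistGE ξ Δ d x) : x ∈ Δ := by
  obtain ⟨τ, -, h1, h2⟩ := hx
  have := (h2 (ξ x) (Metric.mem_ball_self hd)).1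
  rwa [h1] at this

/-- Cauchy's estimates on the disc of radius `d`. -/
theorem maj_of_boundaryDistGE (hd : 0 < d) {f : G → ℂ} (hf : ∀ y ∈ Δ, AnalyticAtPt hξ f y)
    {x : G} (hx : BoundaryDistGE ξ Δ d x) {C : ℝ}
    (hC : ∀ y ∈ Δ, ‖ξ y - ξ x‖ ≤ d → ‖f y‖ ≤ C) : Maj hξ d f x C 1 := by
  have hxΔ := hx.mem hd
  obtain ⟨τ, hτc, hτx, hτ⟩ := hx
  have hloc : ∀ w ∈ Metric.ball (ξ x) d, (fun v => f (τ v)) =ᶠ[𝓝 w] germ hξ f (τ w) := by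
    intro w hw
    have hcont : ContinuousAt τ w := hτc.continuousAt (Metric.isOpen_ball.mem_nhds hw)
    filter_upwards [eventually_eq_localInv hξ hcont, Metric.isOpen_ball.mem_nhds hw] with v hv hvb
    rw [(hτ v hvb).2] at hv
    simp only [germ]
    rw [← hv]
  have hdiff : DifferentiableOn ℂ (fun v => f (τ v)) (Metric.ball (ξ x) d) := by
    intro w hw
    have h1 : AnalyticAt ℂ (germ hξ f (τ w)) (ξ (τ w)) := hf _ (hτ w hw).1
    rw [(hτ w hw).2] at h1
    exact (h1.congr (hloc w hw).symm).differentiableAt.differentiableWithinAt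
  refine ⟨hf x hxΔ, fun i => ?_⟩
  have h2 := hloc (ξ x) (Metric.mem_ball_self hd)
  rw [hτx] at h2
  rw [← h2.iteratedDeriv_eq i, Nat.one_ascFactorial]
  -- The section `τ` exists only over the open disc, so Cauchy's estimate is applied for r < d and r
  -- then tends to d; no part of the radius is lost.
  have hlim : Tendsto (fun r : ℝ => i.factorial * C / r ^ i) (𝓝[<] d)
      (𝓝 (i.factorial * C / d ^ i)) := by
    refine Tendsto.mono_left ?_ nhdsWithin_le_nhds
    exact tendsto_const_nhds.div (tendsto_id.pow i) (by positivity)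
  rw [show C * (i.factorial / d ^ i) = i.factorial * C / d ^ i by ring]
  refine ge_of_tendsto hlim ?_
  filter_upwards [Ioo_mem_nhdsLT hd] with r hr
  refine Complex.norm_iteratedDeriv_le_of_forall_mem_sphere_norm_le i hr.1
    (hdiff.diffContOnCl_ball (Metric.closedBall_subset_ball hr.2)) fun w hw => ?_
  have hwb : w ∈ Metric.ball (ξ x) d :=
    Metric.closedBall_subset_ball hr.2 (Metric.sphere_subset_closedBall hw)
  refine hC _ (hτ w hwb).1 ?_
  rw [(hτ w hwb).2]
  exact (mem_ball_iff_norm.1 hwb).le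

theorem BorelCondition.exists_coeff_maj (hΔ : IsOpen Δ) (hd : 0 < d) {R : ℝ} (hR : 0 < R)
    (hRr : R < aConst n * d') (h : BorelCondition n hξ Δ ψ Ψ d' c ρ σ')
    (hψ : HasExpansion n Δ ψ ψc) :
    ∃ C : ℝ, 0 < C ∧ ∀ x, BoundaryDistGE ξ Δ d x → ∀ k < n - 1, ∀ m : ℕ,
      Maj hξ d (ψc k (m + 1)) x (C * (m.factorial / R ^ m) * wt ρ (ξ x)) 1 := by
  obtain ⟨K, hK, hKw⟩ := exists_wt_le h.rho_pos hd
  have hc := h.c_pos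
  refine ⟨c * Real.exp (σ' * R) * K, by positivity, fun x hx k hk m => ?_⟩
  refine maj_of_boundaryDistGE hd
    (fun y hy => h.coeff_analytic hΔ (hR.trans hRr) hψ hk hy (by omega)) hx fun y hy hyx => ?_
  refine (h.coeff_norm_le hR hRr hψ hk hy (by omega)).trans ?_
  rw [Nat.add_sub_cancel]
  calc c * Real.exp (σ' * R) * (m.factorial / R ^ m) * wt ρ (ξ y)
      ≤ c * Real.exp (σ' * R) * (m.factorial / R ^ m) * (K * wt ρ (ξ x)) := by
        gcongr
        exact hKw _ _ hyx
    _ = _ := by ring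

end Potentials

end BorelGevrey

/-! ### Majorants on the surface, Bell polynomials and the integrand of the recurrence. -/

namespace BorelGevrey

open Filter Finset MeasureTheory

section Majorants

variable {G : Type*} [TopologicalSpace G] {ξ : G → ℂ} {hξ : IsLocalHomeomorph ξ}
  {d ρ C C' : ℝ} {N : ℕ} {f g : G → ℂ} {x : G}

theorem Maj.const_mul (h : Maj hξ d f x C N) (b : ℂ) :
    Maj hξ d (fun y => b * f y) x (‖b‖ * C) N := MajAt.const_mul h b

theorem Maj.sub (h : Maj hξ d f x C N) (h' : Maj hξ d g x C' N) :
    Maj hξ d (fun y => f y - g y) x (C + C') N := MajAt.sub h h'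

theorem Maj.neg (h : Maj hξ d f x C N) : Maj hξ d (fun y => -f y) x C N := MajAt.neg h

theorem Maj.sum {ι : Type*} {s : Finset ι} {f : ι → G → ℂ} {C : ι → ℝ}
    (h : ∀ i ∈ s, Maj hξ d (f i) x (C i) N) :
    Maj hξ d (fun y => ∑ i ∈ s, f i y) x (∑ i ∈ s, C i) N := MajAt.sum h

theorem Maj.one (hd : 0 < d) (N : ℕ) : Maj hξ d (fun _ => 1) x 1 N := MajAt.one d _ N hd

theorem Maj.nonneg (h : Maj hξ d f x C N) : 0 ≤ C := MajAt.nonneg h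

/-- Integration of a majorant. -/
theorem Maj.of_dxi (hd : 0 < d) (hf : AnalyticAtPt hξ f x) (h0 : ‖f x‖ ≤ C)
    (h1 : Maj hξ d (BorelGevrey.dxi hξ 1 f) x C' (N + 1)) (hC : C' * d ≤ C * N) :
    Maj hξ d f x C N := by
  refine ⟨hf, fun i => ?_⟩
  rcases i with _ | s
  · simpa [germ_self] using h0
  · have h2 := (h1.dxi s).norm_le
    rw [dxi_dxi] at h2
    refine h2.trans ?_
    -- The factor N split off here is what integration gains; it explains the condition `hC`, where
    -- C' d is compared with C N.
    have h3 : N.ascFactorial (s + 1) = N * (N + 1).ascFactorial s := by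
      rw [add_comm s 1, ← Nat.ascFactorial_mul_ascFactorial]
      simp [Nat.ascFactorial_succ]
    rw [h3, pow_succ]
    push_cast
    calc C' * (((N + 1).ascFactorial s : ℝ) / d ^ s)
        = (C' * d) * ((N + 1).ascFactorial s / (d ^ s * d)) := by field_simp
      _ ≤ (C * N) * ((N + 1).ascFactorial s / (d ^ s * d)) := by gcongr
      _ = _ := by ring

theorem DecayOn.of_maj {Γ : Set G} (h : ∀ x ∈ Γ, Maj hξ d f x (C * wt ρ (ξ x)) N) :
    DecayOn hξ ρ Γ f := by
  refine ⟨fun x hx => (h x hx).analytic, ⟨C, fun x hx => (h x hx).norm_le⟩,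
    ⟨C * (N.ascFactorial 1 / d ^ 1), fun x hx => ?_⟩⟩
  refine ((h x hx).dxi 1).norm_le.trans (le_of_eq ?_)
  ring

theorem norm_rootExp (n j e : ℕ) : ‖rootExp n j e‖ = 1 := by
  have : (2 * Real.pi * Complex.I * (j : ℂ) * (e : ℂ) / (n : ℂ)) =
      ((2 * Real.pi * j * e / n : ℝ) : ℂ) * Complex.I := by
    push_cast; ring
  rw [rootExp, this, Complex.norm_exp_ofReal_mul_I]

/-! Majorants for the Bell polynomials. -/

/-- The majorant constants of the Bell polynomials. -/
noncomputable def bellConst (d C : ℝ) : ℕ → ℝ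
  | 0 => 1
  | p + 1 => ∑ q : Fin (p + 1), (p.choose q : ℝ) * (C * ((q : ℕ).factorial / d ^ (q : ℕ))) *
      bellConst d C (p - q)

theorem bellConst_nonneg (hd : 0 < d) (hC : 0 ≤ C) (p : ℕ) : 0 ≤ bellConst d C p := by
  induction p using Nat.strong_induction_on with
  | _ p ih =>
  rcases p with _ | p
  · simp [bellConst]
  · rw [bellConst]
    exact sum_nonneg fun q _ => mul_nonneg (by positivity) (ih _ (by omega))

/-- Each summand of B_{p+1} is X^{(q+1)} B_{p-q}, of exponent (q+1)+(p-q) = p+1. The weight of the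
derivative of X is kept and that of the Bell factor is bounded by 1, so every B_p with p ≥ 1 retains
one weight. -/
theorem maj_bellOf (hd : 0 < d) (hC : 0 ≤ C) {X : G → ℂ} {w : ℝ} (hw1 : w ≤ 1)
    (hX : Maj hξ d (dxi hξ 1 X) x (C * w) 1) (p : ℕ) :
    Maj hξ d (bellOf hξ X p) x (bellConst d C p * if p = 0 then 1 else w) p := by
  induction p using Nat.strong_induction_on with
  | _ p ih =>
  rcases p with _ | p
  · have h1 : bellOf hξ X 0 = fun _ => 1 := by
      funext y
      rw [bellOf, completeBell]
    rw [h1]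
    simpa [bellConst] using Maj.one hd 0
  · have h1 : bellOf hξ X (p + 1) = fun y => ∑ q : Fin (p + 1),
        (p.choose q : ℂ) * (dxi hξ (q + 1) X y * bellOf hξ X (p - q) y) := by
      funext y
      rw [bellOf, completeBell]
      exact sum_congr rfl fun q _ => by rw [bellOf]; ring
    rw [h1, if_neg (Nat.succ_ne_zero p), bellConst, sum_mul]
    refine Maj.sum fun q _ => ?_
    have hq : (q : ℕ) ≤ p := Nat.lt_succ_iff.1 q.2
    have h2 := hX.dxi q
    rw [dxi_dxi, Nat.one_ascFactorial] at h2
    have h3 : Maj hξ d (bellOf hξ X (p - q)) x (bellConst d C (p - q)) (p - q) := by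
      refine (ih (p - q) (by omega)).mono hd ?_ le_rfl
      refine mul_le_of_le_one_right (bellConst_nonneg hd hC _) ?_
      split_ifs <;> simp [hw1]
    have h4 := (h2.mul hd h3).const_mul (p.choose q : ℂ)
    refine h4.mono hd (le_of_eq ?_) (by omega)
    rw [Complex.norm_natCast]
    ring

end Majorants

/-! Linear combinations of integrals along a ray. -/

section Linear

variable {G : Type*} {ξ : G → ℂ} {α : ℝ} {x : G} {f g : G → ℂ} {I J : ℂ}

/-- The integral of `f` along the ray converges absolutely and has the value `I`. -/
def HasRayIntegral [TopologicalSpace G] (ξ : G → ℂ) (α : ℝ) (f : G → ℂ) (x : G) (I : ℂ) : Prop :=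
  RayIntegrable ξ α f x ∧ rayIntegral ξ α f x = I

variable [TopologicalSpace G]

theorem HasRayIntegral.const_mul (h : HasRayIntegral ξ α f x I) (b : ℂ) :
    HasRayIntegral ξ α (fun y => b * f y) x (b * I) := by
  refine ⟨h.1.const_mul b, ?_⟩
  rw [← h.2, rayIntegral, rayIntegral, integral_const_mul]
  ring

theorem HasRayIntegral.sub (h : HasRayIntegral ξ α f x I) (h' : HasRayIntegral ξ α g x J) :
    HasRayIntegral ξ α (fun y => f y - g y) x (I - J) := by
  refine ⟨h.1.sub h'.1, ?_⟩
  rw [← h.2, ← h'.2, rayIntegral, rayIntegral, rayIntegral, integral_sub h.1 h'.1]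
  ring

theorem HasRayIntegral.sum {ι : Type*} {s : Finset ι} {f : ι → G → ℂ} {I : ι → ℂ}
    (h : ∀ i ∈ s, HasRayIntegral ξ α (f i) x (I i)) :
    HasRayIntegral ξ α (fun y => ∑ i ∈ s, f i y) x (∑ i ∈ s, I i) := by
  refine ⟨integrable_finsetSum s fun i hi => (h i hi).1, ?_⟩
  rw [rayIntegral, integral_finsetSum s fun i hi => (h i hi).1, mul_sum]
  exact sum_congr rfl fun i hi => (h i hi).2

theorem RayIntegrable.hasRayIntegral (h : RayIntegrable ξ α f x) :
    HasRayIntegral ξ α f x (rayIntegral ξ α f x) := ⟨h, rfl⟩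

end Linear

/-! The integrand of the recurrence. -/

section Recurrence

variable {G : Type*} [TopologicalSpace G] {ξ : G → ℂ}

/-- The integrand of the right-hand side of the recurrence. -/
noncomputable def recIntegrand (n j : ℕ) (hξ : IsLocalHomeomorph ξ) (X : G → ℂ)
    (ψc : ℕ → ℕ → G → ℂ) (A : ℕ → G → ℂ) (m : ℕ) (y : G) : ℂ :=
  1 / (n : ℂ) * ∑ p ∈ Icc 2 (min n (m + 1)), (n.choose p : ℂ) * rootExp n j (n - p + 1) *
      ∑ r ∈ range (p + 1), (p.choose r : ℂ) * recTerm hξ X p r (fun _ => 1) (A (m + 1 - p)) y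
  - 1 / (n : ℂ) * ∑ k ∈ range (n - 1), ∑ p ∈ Icc 1 (min m k),
      (k.choose p : ℂ) * rootExp n j (k - p + 1) *
        ∑ r ∈ range (p + 1), (p.choose r : ℂ) * recTerm hξ X p r (ψc k 1) (A (m - p)) y
  - 1 / (n : ℂ) * ∑ k ∈ range (n - 1), ∑ q ∈ range m, ∑ p ∈ range (min k q + 1),
      (k.choose p : ℂ) * rootExp n j (k - p + 1) *
        ∑ r ∈ range (p + 1), (p.choose r : ℂ) *
          recTerm hξ X p r (ψc k (m - q + 1)) (A (q - p)) y

variable {hξ : IsLocalHomeomorph ξ} {n j : ℕ} {α : ℝ} {ψc : ℕ → ℕ → G → ℂ} {m : ℕ} {x : G}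

/-- Collects the many integrals of the recurrence into one, so that A_m can be differentiated as a
single ray integral. -/
theorem RecurrenceConverges.hasRayIntegral
    (h : RecurrenceConverges n j hξ α ψc m x) (hm : 1 ≤ m) :
    HasRayIntegral ξ α (recIntegrand n j hξ (XFun n j ξ α ψc) ψc (coeff n j hξ α ψc) m) x
      (coeff n j hξ α ψc m x) := by
  rw [coeff_eq_recRHS n j hξ α ψc hm]
  unfold recRHS recIntegrand
  refine ((HasRayIntegral.const_mul (HasRayIntegral.sum fun p hp => ?_) _).sub
    (HasRayIntegral.const_mul (HasRayIntegral.sum fun k hk => HasRayIntegral.sum fun p hp => ?_)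
      _)).sub (HasRayIntegral.const_mul (HasRayIntegral.sum fun k hk => HasRayIntegral.sum
        fun q hq => HasRayIntegral.sum fun p hp => ?_) _)
  · exact (HasRayIntegral.sum fun r hr =>
      (h.first p hp r hr).hasRayIntegral.const_mul _).const_mul _
  · exact (HasRayIntegral.sum fun r hr =>
      (h.second k hk p hp r hr).hasRayIntegral.const_mul _).const_mul _
  · exact (HasRayIntegral.sum fun r hr =>
      (h.third k hk q hq p hp r hr).hasRayIntegral.const_mul _).const_mul _

end Recurrence

end BorelGevrey

/-! ### Bounds for the individual terms of the recurrence under the induction hypothesis. -/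

namespace BorelGevrey

open Filter Finset MeasureTheory

/-- The gain of one unit on the right keeps the products of a coefficient and a potential at order
m! instead of (m+1)!. -/
theorem factorial_succ_mul_factorial_succ_le (a b : ℕ) :
    (a + 1).factorial * (b + 1).factorial ≤ (a + b + 1).factorial := by
  induction b with
  | zero => simp
  | succ b ih =>
    rw [Nat.factorial_succ (b + 1), show a + (b + 1) + 1 = (a + b + 1) + 1 by ring,
      Nat.factorial_succ (a + b + 1)]
    calc (a + 1).factorial * ((b + 1 + 1) * (b + 1).factorial)
        = (b + 1 + 1) * ((a + 1).factorial * (b + 1).factorial) := by ring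
      _ ≤ (a + b + 1 + 1) * (a + b + 1).factorial := Nat.mul_le_mul (by omega) ih

/-- The potentials, with their majorants, on a domain closed under the rays in the direction `α`. -/
structure RayData {G : Type*} [TopologicalSpace G] {ξ : G → ℂ} (hξ : IsLocalHomeomorph ξ) (n : ℕ)
    (α : ℝ) (Γ : Set G) (ψc : ℕ → ℕ → G → ℂ) (d ρ C R K : ℝ) : Prop where
  two_le : 2 ≤ n
  isOpen : IsOpen Γ
  rayClosed : RayClosed ξ α Γ
  d_pos : 0 < d
  rho_pos : 0 < ρ
  C_pos : 0 < C
  potential : ∀ x ∈ Γ, ∀ k < n - 1, ∀ m : ℕ,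
    Maj hξ d (ψc k (m + 1)) x (C * (m.factorial / R ^ m) * wt ρ (ξ x)) 1
  one_le_K : 1 ≤ K
  integral_wt : ∀ z : ℂ, ∫ t in Set.Ioi (0 : ℝ), wt ρ (z + t * Complex.exp (α * Complex.I)) ≤
    K / max 1 (z * Complex.exp (-α * Complex.I)).re ^ ρ

section Induction

variable {G : Type*} [TopologicalSpace G] {ξ : G → ℂ} {hξ : IsLocalHomeomorph ξ}
  {n : ℕ} {α : ℝ} {Γ : Set G} {ψc : ℕ → ℕ → G → ℂ} {d ρ C R K e : ℝ} {Q : ℕ → ℝ}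
  {A : ℕ → G → ℂ} {X : G → ℂ}

/-- The majorant of the `m`-th coefficient. -/
structure CoeffBound (hξ : IsLocalHomeomorph ξ) (Γ : Set G) (d ρ K e : ℝ) (Q : ℕ → ℝ)
    (A : ℕ → G → ℂ) (m : ℕ) : Prop where
  analytic : ∀ x ∈ Γ, AnalyticAtPt hξ (A m) x
  norm_le : ∀ x ∈ Γ, ‖A m x‖ ≤ Q m * ((m + 1).factorial / e ^ m) * K
  maj : ∀ x ∈ Γ, Maj hξ d (dxi hξ 1 (A m)) x
    (Q m * ((m + 1).factorial / e ^ m) * wt ρ (ξ x)) (m + 2)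

theorem CoeffBound.maj_dxi_of_pos {m : ℕ} (h : CoeffBound hξ Γ d ρ K e Q A m) {x : G} (hx : x ∈ Γ)
    {r : ℕ} (hr : 1 ≤ r) : Maj hξ d (dxi hξ r (A m)) x
      (Q m * ((m + r).factorial / e ^ m) * (1 / d ^ (r - 1)) * wt ρ (ξ x)) (m + 1 + r) := by
  obtain ⟨s, rfl⟩ : ∃ s, r = s + 1 := ⟨r - 1, by omega⟩
  have h1 := (h.maj x hx).dxi s
  rw [dxi_dxi] at h1
  rw [show m + 1 + (s + 1) = m + 2 + s by ring, show m + (s + 1) = m + 1 + s by ring,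
    ← Nat.factorial_mul_ascFactorial, Nat.add_sub_cancel]
  convert h1 using 1
  push_cast
  ring

/-- One bound for all r ≤ n, at the cost of a constant independent of m. For r = 0 the majorant of
A_m' is integrated: the weight is lost, and the factorial is that of r = 1, whence `max r 1`. -/
theorem CoeffBound.maj_dxi (hd : 0 < d) (he : 0 < e) (hK : 1 ≤ K) {m : ℕ} (hQ : 0 ≤ Q m)
    (h : CoeffBound hξ Γ d ρ K e Q A m) {x : G} (hx : x ∈ Γ) {r : ℕ} (hr : r ≤ n) :
    Maj hξ d (dxi hξ r (A m)) x ((d + K) * (1 + 1 / d) ^ n * Q m *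
      ((m + max r 1).factorial / e ^ m) * if r = 0 then 1 else wt ρ (ξ x)) (m + 1 + r) := by
  have hK2 : 1 ≤ (1 + 1 / d) ^ n := one_le_pow₀ (by linarith [one_div_pos.2 hd])
  have hw := (wt_pos ρ (ξ x)).le
  rcases Nat.eq_zero_or_pos r with rfl | hr0
  · rw [dxi_zero, if_pos rfl, max_eq_right zero_le_one, mul_one, add_zero]
    set T := Q m * ((m + 1).factorial / e ^ m)
    have hT : 0 ≤ T := by positivity
    have h1 : Maj hξ d (A m) x (T * (d + K)) (m + 1) := by
      refine Maj.of_dxi hd (h.analytic x hx) ((h.norm_le x hx).trans ?_) (h.maj x hx) ?_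
      · exact mul_le_mul_of_nonneg_left (by linarith) hT
      · have h2 : (1 : ℝ) ≤ (m + 1 : ℕ) := by
          push_cast
          linarith [(Nat.cast_nonneg m : (0 : ℝ) ≤ m)]
        calc T * wt ρ (ξ x) * d ≤ T * 1 * (d + K) := by
              gcongr
              · exact wt_le_one _ _
              · linarith
          _ ≤ T * (d + K) * (m + 1 : ℕ) := by
              rw [mul_one]
              exact le_mul_of_one_le_right (by positivity) h2
    refine h1.mono hd ?_ le_rfl
    calc T * (d + K) ≤ T * (d + K) * (1 + 1 / d) ^ n := le_mul_of_one_le_right (by positivity) hK2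
      _ = _ := by simp only [T]; ring
  · refine (h.maj_dxi_of_pos hx hr0).mono hd ?_ le_rfl
    rw [if_neg (by omega), max_eq_left hr0]
    refine mul_le_mul_of_nonneg_right ?_ hw
    have h2 : 1 / d ^ (r - 1) ≤ (1 + 1 / d) ^ n := by
      rw [← one_div_pow]
      have h3 : 0 < 1 / d := by positivity
      calc (1 / d) ^ (r - 1) ≤ (1 + 1 / d) ^ (r - 1) := by gcongr; linarith
        _ ≤ _ := pow_le_pow_right₀ (by linarith) (by omega)
    have hT : 0 ≤ Q m * ((m + r).factorial / e ^ m) := by positivity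
    calc Q m * ((m + r).factorial / e ^ m) * (1 / d ^ (r - 1))
        ≤ Q m * ((m + r).factorial / e ^ m) * (1 + 1 / d) ^ n := by gcongr
      _ ≤ (d + K) * (Q m * ((m + r).factorial / e ^ m) * (1 + 1 / d) ^ n) :=
          le_mul_of_one_le_left (by positivity) (by linarith)
      _ = _ := by ring

/-- The majorant constants of the terms of lower order. -/
noncomputable def lowerConst (n : ℕ) (d C K e : ℝ) : ℝ :=
  (∑ p ∈ range (n + 1), bellConst d C p) * (1 + C) * ((d + K) * (1 + 1 / d) ^ n) * (1 + e) ^ n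

theorem bellConst_le (hd : 0 < d) (hC : 0 ≤ C) {p : ℕ} (hp : p ≤ n) :
    bellConst d C p ≤ ∑ p ∈ range (n + 1), bellConst d C p :=
  single_le_sum (f := bellConst d C) (fun i _ => bellConst_nonneg hd hC i)
    (mem_range.2 (by omega))

/-- A derivative of positive order of A_i carries the weight and A_i itself does not. The other
factor must supply the weight exactly when r = 0, so the product always has one. -/
theorem maj_recTerm (hd : 0 < d) (he : 0 < e) (hK : 1 ≤ K) {i : ℕ} (hQ : 0 ≤ Q i)
    (h : CoeffBound hξ Γ d ρ K e Q A i) {x : G} (hx : x ∈ Γ) {p r : ℕ} (hr : r ≤ n) {f : G → ℂ}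
    {S : ℝ} {N : ℕ} (hf : Maj hξ d (fun y => bellOf hξ X (p - r) y * f y) x
      (S * if r = 0 then wt ρ (ξ x) else 1) N) :
    Maj hξ d (recTerm hξ X p r f (A i)) x
      (S * ((d + K) * (1 + 1 / d) ^ n * Q i * ((i + max r 1).factorial / e ^ i)) * wt ρ (ξ x))
      (N + (i + 1 + r)) := by
  refine (hf.mul hd (h.maj_dxi hd he hK hQ hx hr)).mono hd (le_of_eq ?_) le_rfl
  split_ifs <;> ring

theorem factorial_div_pow_le (he : 0 < e) {i l m : ℕ} (hl : l ≤ m) (him : i ≤ m)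
    (hmi : m - i ≤ n) :
    (l.factorial : ℝ) / e ^ i ≤ (m.factorial / e ^ m) * (1 + e) ^ n := by
  have h1 : (l.factorial : ℝ) ≤ m.factorial := by exact_mod_cast Nat.factorial_le hl
  have h2 : e ^ (m - i) ≤ (1 + e) ^ n :=
    (pow_le_pow_left₀ he.le (by linarith) _).trans (pow_le_pow_right₀ (by linarith) hmi)
  have h3 : e ^ m = e ^ i * e ^ (m - i) := by rw [← pow_add, Nat.add_sub_cancel' him]
  calc (l.factorial : ℝ) / e ^ i ≤ m.factorial / e ^ i := by gcongr
    _ = (m.factorial / e ^ m) * e ^ (m - i) := by rw [h3]; field_simp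
    _ ≤ _ := by gcongr

/-- As r < p and p ≥ 2, the factorial is at most m!, one order below the main terms. For r = 0 the
weight comes from the Bell polynomial B_p. -/
theorem maj_recTerm_first (hQ0 : ∀ m, 0 ≤ Q m) (hQm : Monotone Q) (hd : 0 < d)
    (he : 0 < e) (hK : 1 ≤ K) (hC : 0 < C) {m : ℕ}
    (h : ∀ i < m, CoeffBound hξ Γ d ρ K e Q A i) {x : G} (hx : x ∈ Γ)
    (hX : Maj hξ d (dxi hξ 1 X) x (C * wt ρ (ξ x)) 1)
    {p r : ℕ} (hp2 : 2 ≤ p) (hpn : p ≤ n) (hpm : p ≤ m + 1) (hr : r < p) :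
    Maj hξ d (recTerm hξ X p r (fun _ => 1) (A (m + 1 - p))) x
      (lowerConst n d C K e * (Q (m - 1) * (m.factorial / e ^ m)) * wt ρ (ξ x)) (m + 2) := by
  have hw := (wt_pos ρ (ξ x)).le
  have hB := maj_bellOf hd hC.le (wt_le_one ρ (ξ x)) hX (p - r)
  rw [if_neg (by omega : ¬ p - r = 0)] at hB
  have hBc := bellConst_le (C := C) hd hC.le (by omega : p - r ≤ n)
  set Bc := ∑ p ∈ range (n + 1), bellConst d C p with hBcdef
  have hBc0 : 0 ≤ Bc := (bellConst_nonneg hd hC.le _).trans hBc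
  have hf : Maj hξ d (fun y => bellOf hξ X (p - r) y * (fun _ => (1 : ℂ)) y) x
      (Bc * if r = 0 then wt ρ (ξ x) else 1) (p - r) := by
    simp only [mul_one]
    refine hB.mono hd (mul_le_mul hBc ?_ hw hBc0) le_rfl
    split_ifs
    · exact le_rfl
    · exact wt_le_one _ _
  refine (maj_recTerm hd he hK (hQ0 _) (h (m + 1 - p) (by omega)) hx (n := n) (by omega) hf).mono
    hd ?_ (by omega)
  refine mul_le_mul_of_nonneg_right ?_ hw
  have h1 := factorial_div_pow_le he (n := n) (i := m + 1 - p) (l := m + 1 - p + max r 1) (m := m)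
    (by omega) (by omega) (by omega)
  have h2 := hQm (show m + 1 - p ≤ m - 1 by omega)
  have h3 := hQ0 (m - 1)
  calc Bc * ((d + K) * (1 + 1 / d) ^ n * Q (m + 1 - p) *
        (((m + 1 - p + max r 1).factorial : ℝ) / e ^ (m + 1 - p)))
      ≤ Bc * ((d + K) * (1 + 1 / d) ^ n * Q (m - 1) * ((m.factorial / e ^ m) * (1 + e) ^ n)) := by
        gcongr
    _ ≤ (1 + C) * (Bc * ((d + K) * (1 + 1 / d) ^ n * Q (m - 1) *
          ((m.factorial / e ^ m) * (1 + e) ^ n))) :=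
        le_mul_of_one_le_left (by positivity) (by linarith)
    _ = _ := by rw [lowerConst, ← hBcdef]; ring

/-- The terms containing a coefficient of a potential. -/
theorem maj_recTerm_potential (hd : 0 < d) (he : 0 < e) (hK : 1 ≤ K) (hC : 0 < C) {i : ℕ}
    (hQi : 0 ≤ Q i) (h : CoeffBound hξ Γ d ρ K e Q A i) {x : G} (hx : x ∈ Γ)
    (hX : Maj hξ d (dxi hξ 1 X) x (C * wt ρ (ξ x)) 1) {f : G → ℂ} {S : ℝ} (hS : 0 ≤ S)
    (hf : Maj hξ d f x (S * wt ρ (ξ x)) 1) {p r : ℕ} (hpn : p ≤ n) (hr : r ≤ p) :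
    Maj hξ d (recTerm hξ X p r f (A i)) x
      ((∑ p ∈ range (n + 1), bellConst d C p) * S * ((d + K) * (1 + 1 / d) ^ n * Q i *
        ((i + max r 1).factorial / e ^ i)) * wt ρ (ξ x)) (p + i + 2) := by
  have hw := (wt_pos ρ (ξ x)).le
  have hB := maj_bellOf hd hC.le (wt_le_one ρ (ξ x)) hX (p - r)
  have hBc := bellConst_le (C := C) hd hC.le (by omega : p - r ≤ n)
  set Bc := ∑ p ∈ range (n + 1), bellConst d C p with hBcdef
  have hB0 := bellConst_nonneg (C := C) hd hC.le (p - r)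
  have hBc0 : 0 ≤ Bc := hB0.trans hBc
  have hf' : Maj hξ d (fun y => bellOf hξ X (p - r) y * f y) x
      ((Bc * S) * if r = 0 then wt ρ (ξ x) else 1) (p - r + 1) := by
    refine (hB.mul hd hf).mono hd ?_ le_rfl
    have h1 : (if p - r = 0 then 1 else wt ρ (ξ x)) ≤ 1 := by
      split_ifs
      · exact le_rfl
      · exact wt_le_one _ _
    have h2 : wt ρ (ξ x) ≤ if r = 0 then wt ρ (ξ x) else 1 := by
      split_ifs
      · exact le_rfl
      · exact wt_le_one _ _
    calc (bellConst d C (p - r) * if p - r = 0 then 1 else wt ρ (ξ x)) * (S * wt ρ (ξ x))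
        ≤ (Bc * 1) * (S * if r = 0 then wt ρ (ξ x) else 1) := by gcongr
      _ = _ := by ring
  exact (maj_recTerm hd he hK hQi h hx (n := n) (by omega) hf').mono hd le_rfl (by omega)

theorem maj_recTerm_second (hQ0 : ∀ m, 0 ≤ Q m) (hQm : Monotone Q) (hd : 0 < d)
    (he : 0 < e) (hK : 1 ≤ K) (hC : 0 < C) {m : ℕ}
    (h : ∀ i < m, CoeffBound hξ Γ d ρ K e Q A i) {x : G} (hx : x ∈ Γ)
    (hX : Maj hξ d (dxi hξ 1 X) x (C * wt ρ (ξ x)) 1) {f : G → ℂ}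
    (hf : Maj hξ d f x (C * wt ρ (ξ x)) 1) {p r : ℕ} (hp1 : 1 ≤ p) (hpn : p ≤ n)
    (hpm : p ≤ m) (hr : r ≤ p) :
    Maj hξ d (recTerm hξ X p r f (A (m - p))) x
      (lowerConst n d C K e * (Q (m - 1) * (m.factorial / e ^ m)) * wt ρ (ξ x)) (m + 2) := by
  have hw := (wt_pos ρ (ξ x)).le
  refine (maj_recTerm_potential hd he hK hC (hQ0 _) (h (m - p) (by omega)) hx hX hC.le hf hpn
    hr).mono hd ?_ (by omega)
  refine mul_le_mul_of_nonneg_right ?_ hw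
  have hBc0 := (bellConst_nonneg hd hC.le _).trans (bellConst_le (C := C) hd hC.le hpn)
  set Bc := ∑ p ∈ range (n + 1), bellConst d C p with hBcdef
  have h1 := factorial_div_pow_le he (n := n) (i := m - p) (l := m - p + max r 1) (m := m)
    (by omega) (by omega) (by omega)
  have h2 := hQm (show m - p ≤ m - 1 by omega)
  have h0 := hQ0 (m - p)
  have h3 := hQ0 (m - 1)
  calc Bc * C * ((d + K) * (1 + 1 / d) ^ n * Q (m - p) *
        (((m - p + max r 1).factorial : ℝ) / e ^ (m - p)))
      ≤ Bc * (1 + C) * ((d + K) * (1 + 1 / d) ^ n * Q (m - 1) *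
          ((m.factorial / e ^ m) * (1 + e) ^ n)) := by
        gcongr
        linarith
    _ = _ := by rw [lowerConst, ← hBcdef]; ring

theorem maj_recTerm_third (hQ0 : ∀ m, 0 ≤ Q m) (hQm : Monotone Q) (hd : 0 < d)
    (he : 0 < e) (hK : 1 ≤ K) (hC : 0 < C) (hR : 0 < R) {m : ℕ}
    (h : ∀ i < m, CoeffBound hξ Γ d ρ K e Q A i) {x : G} (hx : x ∈ Γ)
    (hX : Maj hξ d (dxi hξ 1 X) x (C * wt ρ (ξ x)) 1) {f : G → ℂ} {q : ℕ} (hq : q < m)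
    (hf : Maj hξ d f x (C * ((m - q).factorial / R ^ (m - q)) * wt ρ (ξ x)) 1) {p r : ℕ}
    (hpn : p ≤ n) (hpq : p ≤ q) (hr : r ≤ p) :
    Maj hξ d (recTerm hξ X p r f (A (q - p))) x
      (lowerConst n d C K e * (Q (m - 1) * (m.factorial / e ^ m)) * (e / R) ^ (m - q) *
        wt ρ (ξ x)) (m + 2) := by
  have hw := (wt_pos ρ (ξ x)).le
  refine (maj_recTerm_potential hd he hK hC (hQ0 _) (h (q - p) (by omega)) hx hX (by positivity)
    hf hpn hr).mono hd ?_ (by omega)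
  refine mul_le_mul_of_nonneg_right ?_ hw
  have hBc0 := (bellConst_nonneg hd hC.le _).trans (bellConst_le (C := C) hd hC.le hpn)
  set Bc := ∑ p ∈ range (n + 1), bellConst d C p with hBcdef
  have h2 := hQm (show q - p ≤ m - 1 by omega)
  have h0 := hQ0 (q - p)
  have h3 := hQ0 (m - 1)
  -- Here the factorial of the coefficient is at most (q+1)!, and (q+1)! (m-q)! ≤ m! since q < m.
  -- The remaining powers leave the factor (e/R)^{m-q}.
  have h4 : ((q - p + max r 1).factorial : ℝ) * (m - q).factorial ≤ m.factorial := by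
    have h5 : (q - p + max r 1).factorial ≤ (q + 1).factorial := Nat.factorial_le (by omega)
    have h6 := factorial_succ_mul_factorial_succ_le q (m - q - 1)
    rw [show m - q - 1 + 1 = m - q by omega, show q + (m - q - 1) + 1 = m by omega] at h6
    exact_mod_cast (Nat.mul_le_mul_right _ h5).trans h6
  have h7 : e ^ p ≤ (1 + e) ^ n :=
    (pow_le_pow_left₀ he.le (by linarith) _).trans (pow_le_pow_right₀ (by linarith) hpn)
  have h8 : e ^ m = e ^ (q - p) * (e ^ p * e ^ (m - q)) := by
    rw [← pow_add, ← pow_add]; congr 1; omega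
  calc Bc * (C * ((m - q).factorial / R ^ (m - q))) * ((d + K) * (1 + 1 / d) ^ n * Q (q - p) *
        (((q - p + max r 1).factorial : ℝ) / e ^ (q - p)))
      = Bc * C * ((d + K) * (1 + 1 / d) ^ n * Q (q - p) *
        ((((q - p + max r 1).factorial : ℝ) * (m - q).factorial) / e ^ m * e ^ p *
          (e / R) ^ (m - q))) := by
        rw [h8, div_pow]
        field_simp
    _ ≤ Bc * (1 + C) * ((d + K) * (1 + 1 / d) ^ n * Q (m - 1) *
          (m.factorial / e ^ m * (1 + e) ^ n * (e / R) ^ (m - q))) := by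
        gcongr
        linarith
    _ = _ := by rw [lowerConst, ← hBcdef]; ring

/-- The terms of the highest order. -/
theorem maj_recTerm_main (hQm : Monotone Q) {a : ℝ} (ha : 0 < a) (hd : 0 < d) {m : ℕ}
    (h : ∀ i < m, CoeffBound hξ Γ d ρ K (a * d) Q A i) {x : G} (hx : x ∈ Γ)
    {p : ℕ} (hp2 : 2 ≤ p) (hpm : p ≤ m + 1) :
    Maj hξ d (recTerm hξ X p p (fun _ => 1) (A (m + 1 - p))) x
      (a ^ (p - 1) * (Q (m - 1) * ((m + 1).factorial / (a * d) ^ m)) * wt ρ (ξ x)) (m + 2) := by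
  have h0 : recTerm hξ X p p (fun _ => 1) (A (m + 1 - p)) = dxi hξ p (A (m + 1 - p)) := by
    funext y
    rw [recTerm, bellOf, Nat.sub_self, completeBell, one_mul, one_mul]
  have hw := (wt_pos ρ (ξ x)).le
  rw [h0]
  refine ((h (m + 1 - p) (by omega)).maj_dxi_of_pos hx (by omega : 1 ≤ p)).mono hd ?_ (by omega)
  refine mul_le_mul_of_nonneg_right ?_ hw
  have h2 := hQm (show m + 1 - p ≤ m - 1 by omega)
  rw [show m + 1 - p + p = m + 1 by omega]
  -- Each derivative beyond the first costs 1/d, whereas the lower index saves p-1 factors of a·d;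
  -- the net factor is a^{p-1}.
  have h3 : (a * d) ^ m = (a * d) ^ (m + 1 - p) * (a ^ (p - 1) * d ^ (p - 1)) := by
    rw [← mul_pow, ← pow_add]; congr 1; omega
  calc Q (m + 1 - p) * ((m + 1).factorial / (a * d) ^ (m + 1 - p)) * (1 / d ^ (p - 1))
      = a ^ (p - 1) * (Q (m + 1 - p) * ((m + 1).factorial / (a * d) ^ m)) := by
        rw [h3]; field_simp
    _ ≤ _ := by gcongr

end Induction

end BorelGevrey

/-! ### Summation of the terms and the induction step. -/

namespace BorelGevrey

open Filter Finset MeasureTheory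

theorem sum_choose_le_two_pow {n k : ℕ} (hk : k ≤ n) {s : Finset ℕ} (hs : s ⊆ range (k + 1)) :
    ∑ p ∈ s, (k.choose p : ℝ) ≤ 2 ^ n := by
  calc ∑ p ∈ s, (k.choose p : ℝ) ≤ ∑ p ∈ range (k + 1), (k.choose p : ℝ) :=
        sum_le_sum_of_subset_of_nonneg hs fun _ _ _ => by positivity
    _ = 2 ^ k := by exact_mod_cast Nat.sum_range_choose k
    _ ≤ 2 ^ n := pow_le_pow_right₀ (by norm_num) hk

/-- The binomial theorem gives (1+a)^n = 1 + na + a·S, where S is the sum; the defining equation of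
a turns this into S = n. This identity makes the main terms reproduce the bound with constant
exactly 1. -/
theorem sum_choose_mul_aConst_pow {n : ℕ} (hn : 2 ≤ n) :
    ∑ p ∈ Icc 2 n, (n.choose p : ℝ) * aConst n ^ (p - 1) = n := by
  obtain ⟨ha, hae⟩ := aConst_spec hn
  set a := aConst n
  obtain ⟨k, rfl⟩ : ∃ k, n = k + 2 := ⟨n - 2, by omega⟩
  have h1 : ∑ p ∈ Icc 2 (k + 2), ((k + 2).choose p : ℝ) * a ^ (p - 1) =
      ∑ i ∈ range (k + 1), ((k + 2).choose (i + 2) : ℝ) * a ^ (i + 1) := by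
    rw [range_eq_Ico]
    exact (sum_Ico_add' (fun p => ((k + 2).choose p : ℝ) * a ^ (p - 1)) 0 (k + 1) 2).symm
  rw [h1]
  have h2 := add_pow a 1 (k + 2)
  rw [sum_range_succ', sum_range_succ', add_comm a 1, hae] at h2
  simp only [one_pow, mul_one, pow_zero, Nat.choose_zero_right, Nat.cast_one, zero_add, pow_one,
    Nat.choose_one_right] at h2
  have h3 : ∑ i ∈ range (k + 1), a ^ (i + 1 + 1) * ((k + 2).choose (i + 1 + 1) : ℝ) =
      a * ∑ i ∈ range (k + 1), ((k + 2).choose (i + 2) : ℝ) * a ^ (i + 1) := by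
    rw [mul_sum]
    refine sum_congr rfl fun i _ => ?_
    ring
  rw [h3] at h2
  have h4 : a * ∑ i ∈ range (k + 1), ((k + 2).choose (i + 2) : ℝ) * a ^ (i + 1) =
      a * ((k + 2 : ℕ) : ℝ) := by linarith
  exact mul_left_cancel₀ ha.ne' h4

theorem sum_pow_sub_le {ν : ℝ} (h0 : 0 ≤ ν) (h1 : ν < 1) (m : ℕ) :
    ∑ q ∈ range m, ν ^ (m - q) ≤ 1 / (1 - ν) := by
  have h2 : ∑ q ∈ range m, ν ^ (m - q) ≤ ∑ q ∈ range (m + 1), ν ^ (m - q) :=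
    sum_le_sum_of_subset_of_nonneg (range_subset_range.2 (Nat.le_succ m)) fun _ _ _ => by positivity
  refine h2.trans ?_
  have h3 := sum_range_reflect (fun i => ν ^ i) (m + 1)
  simp only [Nat.add_sub_cancel] at h3
  rw [h3, one_div, ← tsum_geometric_of_lt_one h0 h1]
  exact (summable_geometric_of_lt_one h0 h1).sum_le_tsum _ fun _ _ => by positivity

section Induction

variable {G : Type*} [TopologicalSpace G] {ξ : G → ℂ} {hξ : IsLocalHomeomorph ξ}
  {n j : ℕ} {α : ℝ} {Γ : Set G} {ψc : ℕ → ℕ → G → ℂ} {d ρ C R K : ℝ} {Q : ℕ → ℝ}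
  {A : ℕ → G → ℂ} {X : G → ℂ}

theorem maj_choose_mul_sum {g : ℕ → G → ℂ} {x : G} {B : ℕ → ℝ} {N p : ℕ} (c i : ℕ)
    (h : ∀ r ≤ p, Maj hξ d (g r) x (B r) N) :
    Maj hξ d (fun y => (c : ℂ) * rootExp n j i * ∑ r ∈ range (p + 1), (p.choose r : ℂ) * g r y) x
      (c * ∑ r ∈ range (p + 1), (p.choose r : ℝ) * B r) N := by
  have h1 := (Maj.sum fun r hr => (h r (Nat.lt_succ_iff.1 (mem_range.1 hr))).const_mul
    (p.choose r : ℂ)).const_mul ((c : ℂ) * rootExp n j i)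
  simpa only [norm_mul, norm_rootExp, mul_one, Complex.norm_natCast] using h1

theorem maj_choose_mul_sum_const (hd : 0 < d) {g : ℕ → G → ℂ} {x : G} {B : ℝ} {N p : ℕ}
    (hpn : p ≤ n) (c i : ℕ) (h : ∀ r ≤ p, Maj hξ d (g r) x B N) :
    Maj hξ d (fun y => (c : ℂ) * rootExp n j i * ∑ r ∈ range (p + 1), (p.choose r : ℂ) * g r y) x
      (c * (2 ^ n * B)) N := by
  have hB : 0 ≤ B := (h 0 (Nat.zero_le _)).nonneg
  refine (maj_choose_mul_sum c i h).mono hd ?_ le_rfl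
  rw [← sum_mul]
  gcongr
  exact sum_choose_le_two_pow hpn subset_rfl

/-- A majorant of the integrand of the recurrence. -/
theorem maj_recIntegrand (hn : 2 ≤ n) (hd : 0 < d) {m : ℕ} {x : G} {Y Z ν : ℝ}
    (hY : 0 ≤ Y) (hZ : 0 ≤ Z) (hν0 : 0 ≤ ν) (hν1 : ν < 1)
    (hmain : ∀ p, 2 ≤ p → p ≤ n → p ≤ m + 1 →
      Maj hξ d (recTerm hξ X p p (fun _ => 1) (A (m + 1 - p))) x (aConst n ^ (p - 1) * Z) (m + 2))
    (hfirst : ∀ p r, 2 ≤ p → p ≤ n → p ≤ m + 1 → r < p →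
      Maj hξ d (recTerm hξ X p r (fun _ => 1) (A (m + 1 - p))) x Y (m + 2))
    (hsecond : ∀ k p r, k < n - 1 → 1 ≤ p → p ≤ k → p ≤ m → r ≤ p →
      Maj hξ d (recTerm hξ X p r (ψc k 1) (A (m - p))) x Y (m + 2))
    (hthird : ∀ k q p r, k < n - 1 → q < m → p ≤ k → p ≤ q → r ≤ p →
      Maj hξ d (recTerm hξ X p r (ψc k (m - q + 1)) (A (q - p))) x (Y * ν ^ (m - q)) (m + 2)) :
    Maj hξ d (recIntegrand n j hξ X ψc A m) x (Z + 2 ^ n * (2 ^ n * Y) * (2 + 1 / (1 - ν)))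
      (m + 2) := by
  have ha := (aConst_spec hn).1
  have hn0 : (0 : ℝ) < n := by exact_mod_cast (by omega : 0 < n)
  have hnorm : ‖1 / (n : ℂ)‖ = 1 / n := by simp
  -- The prefactor 1/n absorbs the sum over the n-1 values of k.
  have hcard : 1 / (n : ℝ) * ((n - 1 : ℕ) : ℝ) ≤ 1 := by
    rw [one_div, inv_mul_le_iff₀ hn0, mul_one]
    exact_mod_cast Nat.sub_le n 1
  -- the first sum
  have h1 : Maj hξ d (fun y => 1 / (n : ℂ) * ∑ p ∈ Icc 2 (min n (m + 1)),
      (n.choose p : ℂ) * rootExp n j (n - p + 1) * ∑ r ∈ range (p + 1), (p.choose r : ℂ) *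
        recTerm hξ X p r (fun _ => 1) (A (m + 1 - p)) y) x (Z + 2 ^ n * (2 ^ n * Y)) (m + 2) := by
    -- The large constant a^{p-1} Z is charged only to r = p, where the binomial coefficient is 1;
    -- every r also receives Y, which is harmless.
    refine ((Maj.sum fun p hp => maj_choose_mul_sum (B := fun r => Y + if r = p then
      aConst n ^ (p - 1) * Z else 0) _ _ fun r hr => ?_).const_mul _).mono hd ?_ le_rfl
    · rw [mem_Icc] at hp
      rcases hr.eq_or_lt with rfl | hr
      · rw [if_pos rfl]
        exact (hmain r hp.1 (by omega) (by omega)).mono hd (by linarith) le_rfl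
      · rw [if_neg (by omega), add_zero]
        exact hfirst p r hp.1 (by omega) (by omega) hr
    · rw [hnorm]
      have h2 : ∀ p ∈ Icc 2 (min n (m + 1)), (n.choose p : ℝ) * ∑ r ∈ range (p + 1),
          (p.choose r : ℝ) * (Y + if r = p then aConst n ^ (p - 1) * Z else 0) ≤
          (n.choose p : ℝ) * (2 ^ n * Y) + (n.choose p : ℝ) * aConst n ^ (p - 1) * Z := by
        intro p hp
        rw [mem_Icc] at hp
        rw [mul_assoc (n.choose p : ℝ) (aConst n ^ (p - 1)), ← mul_add]
        refine mul_le_mul_of_nonneg_left ?_ (by positivity)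
        simp only [mul_add, sum_add_distrib, mul_ite, mul_zero, sum_ite_eq', ← sum_mul]
        rw [if_pos (mem_range.2 (Nat.lt_succ_self p)), Nat.choose_self, Nat.cast_one, one_mul]
        gcongr
        exact sum_choose_le_two_pow (by omega) subset_rfl
      have h3 : ∑ p ∈ Icc 2 (min n (m + 1)), (n.choose p : ℝ) * aConst n ^ (p - 1) ≤ n := by
        rw [← sum_choose_mul_aConst_pow hn]
        refine sum_le_sum_of_subset_of_nonneg (Icc_subset_Icc_right (min_le_left _ _))
          fun _ _ _ => by positivity
      have h4 : ∑ p ∈ Icc 2 (min n (m + 1)), (n.choose p : ℝ) ≤ 2 ^ n :=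
        sum_choose_le_two_pow le_rfl fun p hp => by
          rw [mem_Icc] at hp
          rw [mem_range]
          omega
      calc 1 / (n : ℝ) * ∑ p ∈ Icc 2 (min n (m + 1)), (n.choose p : ℝ) * ∑ r ∈ range (p + 1),
            (p.choose r : ℝ) * (Y + if r = p then aConst n ^ (p - 1) * Z else 0)
          ≤ 1 / (n : ℝ) * (2 ^ n * (2 ^ n * Y) + n * Z) := by
            refine mul_le_mul_of_nonneg_left ((sum_le_sum h2).trans ?_) (by positivity)
            rw [sum_add_distrib, ← sum_mul, ← sum_mul]
            gcongr
        _ = 1 / (n : ℝ) * (2 ^ n * (2 ^ n * Y)) + Z := by field_simp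
        _ ≤ 1 * (2 ^ n * (2 ^ n * Y)) + Z := by
            gcongr
            rw [div_le_one hn0]
            exact_mod_cast (by omega : 1 ≤ n)
        _ = _ := by ring
  have h2 : Maj hξ d (fun y => 1 / (n : ℂ) * ∑ k ∈ range (n - 1), ∑ p ∈ Icc 1 (min m k),
      (k.choose p : ℂ) * rootExp n j (k - p + 1) * ∑ r ∈ range (p + 1), (p.choose r : ℂ) *
        recTerm hξ X p r (ψc k 1) (A (m - p)) y) x (2 ^ n * (2 ^ n * Y)) (m + 2) := by
    refine ((Maj.sum fun k hk => (Maj.sum fun p hp => maj_choose_mul_sum_const (B := Y) hd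
      ?_ _ _ fun r hr => ?_).mono hd (C' := 2 ^ n * (2 ^ n * Y)) ?_ le_rfl).const_mul _).mono hd
        ?_ le_rfl
    · rw [mem_Icc] at hp
      rw [mem_range] at hk
      omega
    · rw [mem_Icc] at hp
      exact hsecond k p r (mem_range.1 hk) hp.1 (by omega) (by omega) hr
    · rw [mem_range] at hk
      rw [← sum_mul]
      gcongr
      refine sum_choose_le_two_pow (by omega : k ≤ n) fun p hp => ?_
      rw [mem_Icc] at hp
      rw [mem_range]
      omega
    · rw [hnorm, sum_const, card_range, nsmul_eq_mul, ← mul_assoc]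
      exact mul_le_of_le_one_left (by positivity) hcard
  have h3 : Maj hξ d (fun y => 1 / (n : ℂ) * ∑ k ∈ range (n - 1), ∑ q ∈ range m,
      ∑ p ∈ range (min k q + 1), (k.choose p : ℂ) * rootExp n j (k - p + 1) *
        ∑ r ∈ range (p + 1), (p.choose r : ℂ) *
          recTerm hξ X p r (ψc k (m - q + 1)) (A (q - p)) y) x
      (2 ^ n * (2 ^ n * Y) * (1 / (1 - ν))) (m + 2) := by
    refine ((Maj.sum fun k hk => (Maj.sum fun q hq => (Maj.sum fun p hp =>
      maj_choose_mul_sum_const (B := Y * ν ^ (m - q)) hd ?_ _ _ fun r hr => ?_).mono hd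
        (C' := 2 ^ n * (2 ^ n * Y) * ν ^ (m - q)) ?_ le_rfl).mono hd
          (C' := 2 ^ n * (2 ^ n * Y) * (1 / (1 - ν))) ?_ le_rfl).const_mul _).mono hd ?_ le_rfl
    · rw [mem_range] at hp hk
      omega
    · rw [mem_range] at hp
      exact hthird k q p r (mem_range.1 hk) (mem_range.1 hq) (by omega) (by omega) hr
    · rw [mem_range] at hk
      rw [← sum_mul, mul_assoc (2 ^ n : ℝ), mul_assoc (2 ^ n : ℝ) Y]
      gcongr
      refine sum_choose_le_two_pow (by omega : k ≤ n) fun p hp => ?_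
      rw [mem_range] at hp ⊢
      omega
    · rw [← mul_sum]
      gcongr
      exact sum_pow_sub_le hν0 hν1 m
    · rw [hnorm, sum_const, card_range, nsmul_eq_mul, ← mul_assoc]
      have : 0 < 1 - ν := by linarith
      exact mul_le_of_le_one_left (by positivity) hcard
  exact ((h1.sub h2).sub h3).mono hd (le_of_eq (by ring)) le_rfl

theorem RayData.maj_XIntegrand (h : RayData hξ n α Γ ψc d ρ C R K) {x : G} (hx : x ∈ Γ) :
    Maj hξ d (XIntegrand n j ψc) x (n * (C * wt ρ (ξ x))) 1 := by
  have hd := h.d_pos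
  have hC := h.C_pos
  have hw := (wt_pos ρ (ξ x)).le
  refine (Maj.sum fun k hk => (h.potential x hx k (mem_range.1 hk) 0).const_mul _).mono hd ?_ le_rfl
  simp only [norm_rootExp, Nat.factorial_zero, Nat.cast_one, pow_zero, div_one, mul_one, one_mul,
    sum_const, card_range, nsmul_eq_mul]
  gcongr
  exact Nat.sub_le n 1

theorem RayData.decayOn_XIntegrand (h : RayData hξ n α Γ ψc d ρ C R K) :
    DecayOn hξ ρ Γ (XIntegrand n j ψc) :=
  DecayOn.of_maj (d := d) (C := n * C) (N := 1) fun x hx => by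
    rw [mul_assoc]
    exact h.maj_XIntegrand hx

theorem CoeffBound.zero (hK : 1 ≤ K) {e : ℝ} (hd : 0 < d) (hQ : 1 ≤ Q 0) :
    CoeffBound hξ Γ d ρ K e Q (coeff n j hξ α ψc) 0 := by
  have h0 : dxi hξ 1 (fun _ : G => (1 : ℂ)) = fun _ => 0 := by
    funext x
    rw [dxi, iteratedDeriv_one, deriv_const]
  refine ⟨fun x _ => ?_, fun x _ => ?_, fun x _ => ?_⟩
  · rw [coeff_zero]
    exact analyticAt_const
  · simpa [coeff_zero] using one_le_mul_of_one_le_of_one_le hQ hK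
  · rw [coeff_zero, h0]
    have hw := (wt_pos ρ (ξ x)).le
    exact (MajAt.zero d _ 0).mono hd (by simp; positivity) (by omega)

variable [T2Space G]

theorem RayData.analytic_XFun (h : RayData hξ n α Γ ψc d ρ C R K) {x : G} (hx : x ∈ Γ) :
    AnalyticAtPt hξ (XFun n j ξ α ψc) x ∧
      dxi hξ 1 (XFun n j ξ α ψc) x = 1 / (n : ℂ) * XIntegrand n j ψc x := by
  refine analyticAtPt_of_hasDerivAt h.isOpen (g := fun x => 1 / (n : ℂ) * XIntegrand n j ψc x)
    (fun y hy => ?_) hx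
  refine ((h.decayOn_XIntegrand.hasDerivAt h.rho_pos h.isOpen h.rayClosed hy).const_mul
    (-(1 / (n : ℂ)))).congr_deriv ?_
  ring

theorem RayData.maj_dxi_XFun (h : RayData hξ n α Γ ψc d ρ C R K) {x : G} (hx : x ∈ Γ) :
    Maj hξ d (dxi hξ 1 (XFun n j ξ α ψc)) x (C * wt ρ (ξ x)) 1 := by
  have hn0 : (n : ℝ) ≠ 0 := by
    have := h.two_le
    positivity
  refine Maj.congr_of_mem h.isOpen hx (fun y hy => (h.analytic_XFun hy).2.symm) ?_
  refine ((h.maj_XIntegrand hx).const_mul (1 / (n : ℂ))).mono h.d_pos (le_of_eq ?_) le_rfl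
  rw [norm_div, norm_one, Complex.norm_natCast]
  field_simp

/-- The induction step. -/
theorem CoeffBound.step (h : RayData hξ n α Γ ψc d ρ C R K) (hR : aConst n * d < R)
    (hQ0 : ∀ m, 0 ≤ Q m) (hQm : Monotone Q) {m : ℕ} (hm : 1 ≤ m)
    (hQs : Q (m - 1) * (m + 1 + 2 ^ n * (2 ^ n * lowerConst n d C K (aConst n * d)) *
      (2 + 1 / (1 - aConst n * d / R))) ≤ Q m * (m + 1))
    (hA : ∀ i < m, CoeffBound hξ Γ d ρ K (aConst n * d) Q (coeff n j hξ α ψc) i) :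
    (∀ x ∈ Γ, RecurrenceConverges n j hξ α ψc m x) ∧
    (∀ x ∈ Γ, ‖coeff n j hξ α ψc m x‖ ≤ Q m * ((m + 1).factorial / (aConst n * d) ^ m) *
      (K / max 1 (ξ x * Complex.exp (-α * Complex.I)).re ^ ρ)) ∧
    CoeffBound hξ Γ d ρ K (aConst n * d) Q (coeff n j hξ α ψc) m := by
  have hd := h.d_pos
  have ha := (aConst_spec h.two_le).1
  have hC := h.C_pos
  have hK := h.one_le_K
  set a := aConst n with ha_def
  have he : 0 < a * d := by positivity
  have hR0 : 0 < R := he.trans hR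
  set e := a * d with he_def
  set X := XFun n j ξ α ψc with hXdef
  set A := coeff n j hξ α ψc with hAdef
  have hX : ∀ x ∈ Γ, Maj hξ d (dxi hξ 1 X) x (C * wt ρ (ξ x)) 1 := fun x hx => h.maj_dxi_XFun hx
  set Y := lowerConst n d C K e * (Q (m - 1) * (m.factorial / e ^ m)) with hYdef
  have hBc0 : 0 ≤ ∑ p ∈ range (n + 1), bellConst d C p :=
    sum_nonneg fun p _ => bellConst_nonneg hd hC.le p
  have hV0 : 0 ≤ lowerConst n d C K e := by unfold lowerConst; positivity
  have hY0 : 0 ≤ Y := mul_nonneg hV0 (mul_nonneg (hQ0 _) (by positivity))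
  set Z := Q (m - 1) * ((m + 1).factorial / e ^ m) with hZdef
  have hZ0 : 0 ≤ Z := mul_nonneg (hQ0 _) (by positivity)
  have hν0 : 0 ≤ e / R := by positivity
  have hν1 : e / R < 1 := (div_lt_one hR0).2 hR
  have hmain : ∀ x ∈ Γ, ∀ p, 2 ≤ p → p ≤ n → p ≤ m + 1 → Maj hξ d
      (recTerm hξ X p p (fun _ => 1) (A (m + 1 - p))) x (a ^ (p - 1) * Z * wt ρ (ξ x)) (m + 2) :=
    fun x hx p hp2 _ hpm => maj_recTerm_main hQm ha hd hA hx hp2 hpm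
  have hfirst : ∀ x ∈ Γ, ∀ p r, 2 ≤ p → p ≤ n → p ≤ m + 1 → r < p →
      Maj hξ d (recTerm hξ X p r (fun _ => 1) (A (m + 1 - p))) x (Y * wt ρ (ξ x)) (m + 2) :=
    fun x hx p r hp2 hpn hpm hr => maj_recTerm_first hQ0 hQm hd he hK hC hA hx
      (hX x hx) hp2 hpn hpm hr
  have hsecond : ∀ x ∈ Γ, ∀ k p r, k < n - 1 → 1 ≤ p → p ≤ k → p ≤ m → r ≤ p →
      Maj hξ d (recTerm hξ X p r (ψc k 1) (A (m - p))) x (Y * wt ρ (ξ x)) (m + 2) :=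
    fun x hx k p r hk hp1 hpk hpm hr => maj_recTerm_second hQ0 hQm hd he hK hC hA hx (hX x hx)
      (by simpa using h.potential x hx k hk 0) hp1 (by omega) hpm hr
  have hthird : ∀ x ∈ Γ, ∀ k q p r, k < n - 1 → q < m → p ≤ k → p ≤ q → r ≤ p →
      Maj hξ d (recTerm hξ X p r (ψc k (m - q + 1)) (A (q - p))) x
        (Y * (e / R) ^ (m - q) * wt ρ (ξ x)) (m + 2) :=
    fun x hx k q p r hk hq hpk hpq hr => maj_recTerm_third hQ0 hQm hd he hK hC hR0 hA hx (hX x hx)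
      hq (h.potential x hx k hk (m - q)) (by omega) hpq hr
  have hconv : ∀ x ∈ Γ, RecurrenceConverges n j hξ α ψc m x := by
    intro x hx
    refine ⟨h.decayOn_XIntegrand.rayIntegrable h.rho_pos h.rayClosed hx, fun p hp r hr => ?_,
      fun k hk p hp r hr => ?_, fun k hk q hq p hp r hr => ?_⟩
    · rw [mem_Icc] at hp
      rw [mem_range] at hr
      rcases (Nat.lt_succ_iff.1 hr).eq_or_lt with rfl | hr'
      · exact (DecayOn.of_maj fun y hy => hmain y hy r hp.1 (by omega) (by omega)).rayIntegrable
          h.rho_pos h.rayClosed hx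
      · exact (DecayOn.of_maj fun y hy => hfirst y hy p r hp.1 (by omega) (by omega)
          hr').rayIntegrable h.rho_pos h.rayClosed hx
    · rw [mem_Icc] at hp
      rw [mem_range] at hr hk
      exact (DecayOn.of_maj fun y hy => hsecond y hy k p r hk hp.1 (by omega) (by omega)
        (by omega)).rayIntegrable h.rho_pos h.rayClosed hx
    · rw [mem_range] at hr hk hq hp
      exact (DecayOn.of_maj fun y hy => hthird y hy k q p r hk hq (by omega) (by omega)
        (by omega)).rayIntegrable h.rho_pos h.rayClosed hx
  set T := Q m * ((m + 1).factorial / e ^ m) with hTdef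
  have hT0 : 0 ≤ T := mul_nonneg (hQ0 _) (by positivity)
  have hF : ∀ x ∈ Γ, Maj hξ d (recIntegrand n j hξ X ψc A m) x (T * wt ρ (ξ x)) (m + 2) := by
    intro x hx
    have hw := (wt_pos ρ (ξ x)).le
    have hmaj := maj_recIntegrand (j := j) (Y := Y * wt ρ (ξ x)) (Z := Z * wt ρ (ξ x)) h.two_le hd
      (by positivity) (by positivity) hν0 hν1
      (fun p h1 h2 h3 => by
        rw [← mul_assoc]
        exact hmain x hx p h1 h2 h3) (hfirst x hx) (hsecond x hx)
      (fun k q p r h1 h2 h3 h4 h5 => by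
        rw [mul_right_comm]
        exact hthird x hx k q p r h1 h2 h3 h4 h5)
    refine hmaj.mono hd ?_ le_rfl
    -- Dividing by m!/e^m turns this into `hQs`: the main part Z has the factor (m+1)!, and
    -- everything of order m! enters the bracket as an additive constant.
    have hstep : Z + 2 ^ n * (2 ^ n * Y) * (2 + 1 / (1 - e / R)) ≤ T := by
      have h1 : 0 ≤ (m.factorial : ℝ) / e ^ m := by positivity
      have h2 := mul_le_mul_of_nonneg_right hQs h1
      simp only [hZdef, hTdef, hYdef, Nat.factorial_succ]
      push_cast
      calc _ = Q (m - 1) * (m + 1 + 2 ^ n * (2 ^ n * lowerConst n d C K e) *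
            (2 + 1 / (1 - e / R))) * (m.factorial / e ^ m) := by ring
        _ ≤ _ := h2
        _ = _ := by ring
    calc _ = (Z + 2 ^ n * (2 ^ n * Y) * (2 + 1 / (1 - e / R))) * wt ρ (ξ x) := by ring
      _ ≤ _ := by gcongr
  have hFd : DecayOn hξ ρ Γ (recIntegrand n j hξ X ψc A m) := DecayOn.of_maj hF
  have hval : ∀ x ∈ Γ, rayIntegral ξ α (recIntegrand n j hξ X ψc A m) x = A m x := fun x hx =>
    ((hconv x hx).hasRayIntegral hm).2
  -- The induction hypothesis bounds the derivative of A_m, and this derivative is minus the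
  -- integrand, so `hF` closes the step without estimating a derivative of an integral.
  have hder : ∀ x ∈ Γ, AnalyticAtPt hξ (A m) x ∧
      dxi hξ 1 (A m) x = -recIntegrand n j hξ X ψc A m x := by
    intro x hx
    refine analyticAtPt_of_hasDerivAt h.isOpen
      (g := fun x => -recIntegrand n j hξ X ψc A m x) (fun y hy => ?_) hx
    refine (hFd.hasDerivAt h.rho_pos h.isOpen h.rayClosed hy).congr_of_eventuallyEq ?_
    filter_upwards [tendsto_localInv hξ y (h.isOpen.mem_nhds hy)] with w hw
    exact (hval _ hw).symm
  have hbound : ∀ x ∈ Γ, ‖A m x‖ ≤ T *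
      (K / max 1 (ξ x * Complex.exp (-α * Complex.I)).re ^ ρ) := by
    intro x hx
    rw [← hval x hx]
    exact (norm_rayIntegral_le h.rho_pos h.rayClosed hξ hx fun y hy => (hF y hy).norm_le).trans
      (mul_le_mul_of_nonneg_left (h.integral_wt _) hT0)
  refine ⟨hconv, hbound, fun x hx => (hder x hx).1, fun x hx => (hbound x hx).trans ?_,
    fun x hx => ?_⟩
  · refine mul_le_mul_of_nonneg_left (div_le_self (by linarith) ?_) hT0
    exact Real.one_le_rpow (le_max_left _ _) h.rho_pos.le
  · exact Maj.congr_of_mem h.isOpen hx (fun y hy => (hder y hy).2.symm) (hF x hx).neg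

end Induction

end BorelGevrey

/-! ### Binomial and factorial inequalities that produce L. -/

namespace BorelGevrey

open Filter Finset

/-- Since C(m-1+κ, κ)(m+κ) = C(m+κ, κ) m, the excess C ≤ κ is paid for by the growth of the binomial
coefficient, and the spare unit by its monotonicity. -/
theorem choose_add_step {κ : ℕ} {C : ℝ} (hC : C ≤ κ) {m : ℕ} (hm : 1 ≤ m) :
    ((m - 1 + κ).choose κ : ℝ) * (m + 1 + C) ≤ (m + κ).choose κ * (m + 1) := by
  obtain ⟨l, rfl⟩ : ∃ l, m = l + 1 := ⟨m - 1, by omega⟩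
  have h1 := Nat.choose_mul_succ_eq (l + κ) κ
  rw [show l + κ + 1 - κ = l + 1 by omega, show l + κ + 1 = l + 1 + κ by ring] at h1
  have h2 : ((l + κ).choose κ : ℝ) * (l + 1 + κ) = (l + 1 + κ).choose κ * (l + 1) := by
    exact_mod_cast h1
  have h3 : ((l + κ).choose κ : ℝ) ≤ (l + 1 + κ).choose κ := by
    exact_mod_cast Nat.choose_le_choose κ (by omega)
  rw [Nat.add_sub_cancel]
  push_cast
  have h4 : ((l + κ).choose κ : ℝ) * C ≤ (l + κ).choose κ * κ := by gcongr
  linarith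

/-- The binomial coefficient costs at most κ extra factors in the factorial; the number b is less
than a power of the next factor and costs b more. -/
theorem choose_mul_factorial_mul_le {κ b m s : ℕ} (hs : 1 ≤ s) :
    (m + κ).choose κ * (m + s).factorial * b ≤ (m + (κ + b) + s).factorial := by
  have h1 : (m + κ).choose κ ≤ (m + s + κ).choose κ := Nat.choose_le_choose κ (by omega)
  have h2 : (m + s + κ).choose κ * (m + s).factorial ≤ (m + s + κ).factorial := by
    rw [← Nat.add_choose_mul_factorial_mul_factorial (m + s) κ]
    exact Nat.le_mul_of_pos_right _ (Nat.factorial_pos κ)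
  have h3 : b ≤ (m + s + κ + 1) ^ b := (Nat.lt_pow_self (by omega)).le
  calc (m + κ).choose κ * (m + s).factorial * b
      ≤ (m + s + κ).choose κ * (m + s).factorial * (m + s + κ + 1) ^ b := by gcongr
    _ ≤ (m + s + κ).factorial * (m + s + κ + 1) ^ b := by gcongr
    _ ≤ (m + s + κ + b).factorial := Nat.factorial_mul_pow_le_factorial
    _ = _ := by congr 1; ring

/-- The induction yields a^{-m} and the claim has a^{-(m-1)}; the surplus 1/a, together with the
constant B, is bounded by the integer b and pushed into the factorial. -/
theorem gevrey_bound {a d B : ℝ} (ha : 0 < a) (hd : 0 < d) {κ b m s : ℕ} (hB : B / a ≤ b)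
    (hm : 1 ≤ m) (hs : 1 ≤ s) :
    ((m + κ).choose κ : ℝ) * ((m + s).factorial / (a * d) ^ m) * B ≤
      1 / a ^ (m - 1) * (1 / d ^ m) * (m + (κ + b) + s).factorial := by
  have h1 : ((m + κ).choose κ : ℝ) * (m + s).factorial * b ≤ (m + (κ + b) + s).factorial := by
    exact_mod_cast choose_mul_factorial_mul_le hs
  have h2 : a ^ m = a ^ (m - 1) * a := by rw [← pow_succ]; congr 1; omega
  calc ((m + κ).choose κ : ℝ) * ((m + s).factorial / (a * d) ^ m) * B
      = 1 / a ^ (m - 1) * (1 / d ^ m) * ((m + κ).choose κ * (m + s).factorial * (B / a)) := by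
        rw [mul_pow, h2]
        field_simp
    _ ≤ 1 / a ^ (m - 1) * (1 / d ^ m) * ((m + κ).choose κ * (m + s).factorial * b) := by gcongr
    _ ≤ _ := by gcongr

end BorelGevrey

theorem proposition2p1 (n : ℕ) (hn : 2 ≤ n)
    {G : Type*} [TopologicalSpace G] [T2Space G] (ξ : G → ℂ) (hξ : IsLocalHomeomorph ξ)
    (Δ : Set G) (hΔ_open : IsOpen Δ) (hΔ_conn : IsConnected Δ)
    (ψ Ψ : ℕ → ℂ → G → ℂ) (ψc : ℕ → ℕ → G → ℂ)
    (hψ : BorelGevrey.HasExpansion n Δ ψ ψc)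
    (d d' c ρ σ' : ℝ) (hd : 0 < d) (hdd' : d < d')
    (hcond : BorelGevrey.BorelCondition n hξ Δ ψ Ψ d' c ρ σ')
    (θ : Fin n → Fin n → ℝ) (hθ : BorelGevrey.IsAngleChoice n θ) :
    ∃ L : ℕ, 0 < L ∧ ∀ (j : Fin n) (Γ : Set G), BorelGevrey.IsGammaDomain ξ Δ θ j d Γ →
      -- the coefficients are well defined and analytic in `Γ`
      (∀ x ∈ Γ,
        (∃ γ : ℝ → G, BorelGevrey.IsRay ξ (BorelGevrey.midAngle θ j) x γ ∧
          ∀ t : ℝ, 0 ≤ t → γ t ∈ Γ) ∧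
        BorelGevrey.AnalyticAtPt hξ (BorelGevrey.XFun n j ξ (BorelGevrey.midAngle θ j) ψc) x ∧
        ∀ m : ℕ, 1 ≤ m →
          BorelGevrey.RecurrenceConverges n j hξ (BorelGevrey.midAngle θ j) ψc m x ∧
          BorelGevrey.AnalyticAtPt hξ
            (BorelGevrey.coeff n j hξ (BorelGevrey.midAngle θ j) ψc m) x) ∧
      -- the Gevrey-type estimates
      ∀ m : ℕ, 1 ≤ m → ∀ x ∈ Γ,
        ‖BorelGevrey.coeff n j hξ (BorelGevrey.midAngle θ j) ψc m x‖
            ≤ 1 / BorelGevrey.aConst n ^ (m - 1) * (1 / d ^ m) *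
              (((m + L + 1).factorial : ℝ) /
                (max 1 (ξ x * Complex.exp (-(BorelGevrey.midAngle θ j) * Complex.I)).re) ^ ρ) ∧
        ∀ s : ℕ, 1 ≤ s →
          ‖BorelGevrey.dxi hξ s (BorelGevrey.coeff n j hξ (BorelGevrey.midAngle θ j) ψc m) x‖
            ≤ 1 / BorelGevrey.aConst n ^ (m - 1) * (1 / d ^ (m + s - 1)) *
              (((m + L + s).factorial : ℝ) / (1 + ‖ξ x‖ ^ (1 + ρ))) := by
  open BorelGevrey in
  have ha := (aConst_spec hn).1
  have hd' : 0 < d' := hd.trans hdd'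
  -- The midpoint of d and d' gives a radius strictly on both sides: below a·d' for Cauchy's
  -- estimate in t, above a·d for the geometric series.
  have hR : aConst n * d < aConst n * ((d + d') / 2) := by gcongr; linarith
  have hRr : aConst n * ((d + d') / 2) < aConst n * d' := by gcongr; linarith
  have hR0 : 0 < aConst n * ((d + d') / 2) := by positivity
  obtain ⟨C, hC, hpot⟩ := hcond.exists_coeff_maj hΔ_open hd hR0 hRr hψ
  obtain ⟨K, hK, hint⟩ := exists_integral_wt_ray_le hcond.rho_pos
  set R := aConst n * ((d + d') / 2)
  set E : ℝ := 2 ^ n * (2 ^ n * lowerConst n d C K (aConst n * d)) *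
    (2 + 1 / (1 - aConst n * d / R))
  -- `κ` and `b` are built from n, d, R, C and K only. These do not depend on j, Γ, m, s or the
  -- point, which gives the uniformity of L = κ + b.
  obtain ⟨κ, hκ⟩ := exists_nat_ge E
  obtain ⟨b, hb⟩ := exists_nat_ge (K / aConst n)
  have hb0 : 0 < b := by
    have h1 : 0 < K / aConst n := by positivity
    exact_mod_cast h1.trans_le hb
  -- As K ≥ 1, the same `b` serves the bound for the coefficients (B = K) and for their derivatives
  -- (B = 1).
  have hb1 : 1 / aConst n ≤ b := le_trans (by gcongr) hb
  refine ⟨κ + b, by omega, fun j Γ hΓ => ?_⟩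
  have hrays := rayClosed_midAngle hξ hn hθ hΓ
  have hdata : RayData hξ n (midAngle θ j) Γ ψc d ρ C R K :=
    ⟨hn, hΓ.isOpen, hrays, hd, hcond.rho_pos, hC,
      fun x hx k hk m => hpot x (hΓ.boundary_dist x hx) k hk m, hK, fun z => hint z _⟩
  set Q : ℕ → ℝ := fun m => ((m + κ).choose κ : ℝ) with hQ
  have hQ0 : ∀ m, 0 ≤ Q m := fun m => Nat.cast_nonneg _
  have hQm : Monotone Q := fun m m' h => by
    simp only [hQ]
    exact_mod_cast Nat.choose_le_choose κ (by omega)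
  have hstep := fun (m : ℕ) (hm : 1 ≤ m) (hA : ∀ i < m, CoeffBound hξ Γ d ρ K (aConst n * d) Q
      (coeff n j hξ (midAngle θ j) ψc) i) =>
    CoeffBound.step hdata hR hQ0 hQm hm (choose_add_step hκ hm) hA
  have hA : ∀ m, CoeffBound hξ Γ d ρ K (aConst n * d) Q (coeff n j hξ (midAngle θ j) ψc) m := by
    intro m
    induction m using Nat.strong_induction_on with
    | _ m ih =>
    rcases Nat.eq_zero_or_pos m with rfl | hm
    · exact CoeffBound.zero hK hd (by simp [hQ])
    · exact (hstep m hm ih).2.2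
  refine ⟨fun x hx => ⟨hrays x hx, (hdata.analytic_XFun hx).1, fun m hm =>
    ⟨(hstep m hm fun i _ => hA i).1 x hx, (hA m).analytic x hx⟩⟩, fun m hm x hx => ⟨?_, ?_⟩⟩
  · refine ((hstep m hm fun i _ => hA i).2.1 x hx).trans ?_
    have h1 := gevrey_bound (κ := κ) ha hd hb hm le_rfl
    have h2 : (0 : ℝ) < max 1 (ξ x * Complex.exp (-(midAngle θ j) * Complex.I)).re ^ ρ :=
      Real.rpow_pos_of_pos (lt_max_of_lt_left one_pos) _
    rw [← mul_div_assoc (_ * _ : ℝ) K, ← mul_div_assoc (_ * _ : ℝ) (Nat.cast _)]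
    exact div_le_div_of_nonneg_right h1 h2.le
  · intro s hs
    refine (((hA m).maj_dxi_of_pos hx hs).norm_le).trans ?_
    have h1 := gevrey_bound (κ := κ) (B := 1) ha hd hb1 hm hs
    rw [mul_one] at h1
    have hw := (wt_pos ρ (ξ x)).le
    have h2 : d ^ (m + s - 1) = d ^ m * d ^ (s - 1) := by rw [← pow_add]; congr 1; omega
    calc Q m * ((m + s).factorial / (aConst n * d) ^ m) * (1 / d ^ (s - 1)) * wt ρ (ξ x)
        ≤ 1 / aConst n ^ (m - 1) * (1 / d ^ m) * (m + (κ + b) + s).factorial * (1 / d ^ (s - 1)) *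
          wt ρ (ξ x) := by gcongr
      _ = _ := by
        rw [h2, wt]
        field_simp
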